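/- Let $0 \le a < b \le \infty$, and let the valuations $v_1,\dots,v_n$ of $n$ agents be drawn i.i.d. from a distribution $F$ with finite mean, with support $R=[a,b]$ ($R=[a,\infty)$ if $b=\infty$) and with a density $f$ that is positive throughout $R$. Assume that the hazard rate $f/(1-F)$ is neither non-decreasing nor non-increasing on $[a,b)$. Let $\vartheta(v)=\frac{1-F(v)}{f(v)}$ and define the ironed virtual valuation $\bar\vartheta$ by: $h(q)=\vartheta(F^{-1}(q))$, $H(q)=\int_0^q h(r)\,dr$, $G$ is the largest convex function on $[0,1]$ with $G\le H$, $g$ is the derivative of $G$ extended by right-continuity (and by the left derivative at $q=1$), and $\bar\vartheta(v)=g(F(v))$. A mechanism for $k$ units maps each profile of actions to a lottery over sets of at most $k$ winners and to non-negative (burnt) expected payments $p_i$; write $x_i$ for the probability that agent $i$ wins. It is considered together with a Bayes–Nash equilibrium that is ex interim individually rational, where agents maximize the expectation of $v_ix_i-p_i$; if $a>0$, payments are normalized so that in equilibrium the lowest type $a$ of each agent has expected utility $0$ (for $a=0$ this holds automatically). It is optimal if its expected residual surplus $\mathbf E\bigl[\sum_i (v_ix_i-p_i)\bigr]$ is at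 least that of every such mechanism and equilibrium, symmetric or not. Let $R'\subseteq R$ be the subrange on which $\bar\vartheta$ increases, i.e. the set of $v\in R$ with $\bar\vartheta(w)<\bar\vartheta(v)$ for all $w\in R$, $w<v$ (so that of each interval on which $\bar\vartheta$ is constant only the lower end point is kept). The indirect $k$-unit Vickrey auction is the mechanism in which each agent submits a bid $s_i\in R'$, the $\min(k,n)$ agents with the highest bids win, ties are broken uniformly at random, and agent $i$ pays in expectation $s_i\,x_i(s)-\int_a^{s_i} x_i(\beta(z),s_{-i})\,dz$, where $\beta(z)$ denotes the largest element of $R'$ that is at most $z$. Then this auction is symmetric; for every $v \in R$ the bid $\beta(v)$ exists and satisfies $\bar\vartheta(\beta(v))=\bar\vartheta(v)$; all agents bidding according to $\beta$ is an ex interim individually rational Bayes–Nash equilibrium; and with this equilibrium the auction is an optimal money-burning mechanism for $k$ units. -/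

import Mathlib

open MeasureTheory ProbabilityTheory Set

noncomputable section

namespace MoneyBurning

/-! ### Valuation distributions -/

/-- The range `R = [a, b]` of valuations; the upper end `b` may be `+∞`. -/
def valueRange (a : ℝ) (b : EReal) : Set ℝ := {v | a ≤ v ∧ (v : EReal) ≤ b}

/-- The law on `ℝ` with density `f`. -/
def law (f : ℝ → ℝ) : Measure ℝ := volume.withDensity fun x => ENNReal.ofReal (f x)

/-- `f` is a probability density with support `[a, b]`, positive throughout this interval, and with
finite mean (automatic for `b < ∞`). -/
structure IsValuationDensity (a : ℝ) (b : EReal) (f : ℝ → ℝ) : Prop where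
  measurable : Measurable f
  pos : ∀ v ∈ valueRange a b, 0 < f v
  zero : ∀ v, v ∉ valueRange a b → f v = 0
  isProbability : IsProbabilityMeasure (law f)
  mean : Integrable (fun v => v) (law f)

/-- The distribution function `F`. -/
def F (f : ℝ → ℝ) (z : ℝ) : ℝ := cdf (law f) z

/-- The hazard rate `f / (1 - F)`, meaningful where `F < 1`. -/
def hazardRate (f : ℝ → ℝ) (v : ℝ) : ℝ := f v / (1 - F f v)

/-- The part of `[a, b]` on which the hazard rate is defined, that is `[a, b)`. -/
def hazardDomain (a : ℝ) (b : EReal) (f : ℝ → ℝ) : Set ℝ := {v ∈ valueRange a b | F f v < 1}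

/-- The hazard rate is monotone in neither direction. -/
def NonMHR (a : ℝ) (b : EReal) (f : ℝ → ℝ) : Prop :=
  ¬ MonotoneOn (hazardRate f) (hazardDomain a b f) ∧
    ¬ AntitoneOn (hazardRate f) (hazardDomain a b f)

/-! ### Virtual valuations for utility and ironing -/

/-- The virtual valuation for utility, `(1 - F) / f`. -/
def virtualValue (f : ℝ → ℝ) (v : ℝ) : ℝ := (1 - F f v) / f v

/-- The inverse of the distribution function on `[a, b]`. -/
def quantile (a : ℝ) (b : EReal) (f : ℝ → ℝ) (q : ℝ) : ℝ := sInf {z ∈ valueRange a b | q ≤ F f z}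

/-- `h(q) = ϑ(F⁻¹(q))`. -/
def hFun (a : ℝ) (b : EReal) (f : ℝ → ℝ) (q : ℝ) : ℝ := virtualValue f (quantile a b f q)

/-- `H(q) = ∫₀^q h(r) dr`. -/
def HFun (a : ℝ) (b : EReal) (f : ℝ → ℝ) (q : ℝ) : ℝ := ∫ r in (0 : ℝ)..q, hFun a b f r

/-- The convex hull of a function on `[0, 1]`: the largest convex function below it. -/
def convexMinorant (H : ℝ → ℝ) (q : ℝ) : ℝ :=
  sSup {y | ∃ c : ℝ → ℝ, ConvexOn ℝ (Icc 0 1) c ∧ (∀ r ∈ Icc (0 : ℝ) 1, c r ≤ H r) ∧ y = c q}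

/-- `G`, the convex hull of `H`. -/
def GFun (a : ℝ) (b : EReal) (f : ℝ → ℝ) : ℝ → ℝ := convexMinorant (HFun a b f)

/-- `g`, the derivative of the convex function `G`, extended by right-continuity on `[0, 1)` (this
is the right derivative); at the end point `1` it is the left derivative. -/
def gFun (a : ℝ) (b : EReal) (f : ℝ → ℝ) (q : ℝ) : ℝ :=
  if q < 1 then derivWithin (GFun a b f) (Ioi q) q else derivWithin (GFun a b f) (Iio 1) 1

/-- The ironed virtual valuation for utility, `g(F(z))`. -/
def ironedValue (a : ℝ) (b : EReal) (f : ℝ → ℝ) (z : ℝ) : ℝ := gFun a b f (F f z)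

/-! ### Mechanisms, equilibria, optimality -/

/-- A (possibly randomized, possibly indirect) mechanism for `n` agents with action space `A`:
an action profile is mapped to a lottery over sets of winners and to the (expected) amount
each agent has to burn. -/
structure Mechanism (n : ℕ) (A : Type) where
  lottery : (Fin n → A) → PMF (Finset (Fin n))
  payment : (Fin n → A) → Fin n → ℝ

namespace Mechanism

variable {n : ℕ} {A : Type}

/-- The probability `xᵢ` that agent `i` is served. -/
def alloc (M : Mechanism n A) (s : Fin n → A) (i : Fin n) : ℝ :=
  ∑ W : Finset (Fin n) with i ∈ W, (M.lottery s W).toReal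

/-- Only sets of at most `k` agents are served, winning probabilities and payments are measurable,
and there are no positive transfers to the agents. -/
structure IsFeasible [MeasurableSpace A] (M : Mechanism n A) (k : ℕ) : Prop where
  units : ∀ s, ∀ W ∈ (M.lottery s).support, W.card ≤ k
  measurable_alloc : ∀ i, Measurable fun s => M.alloc s i
  measurable_payment : ∀ i, Measurable fun s => M.payment s i
  payment_nonneg : ∀ s i, 0 ≤ M.payment s i

/-- Renaming the agents renames the outcome. -/
def IsSymmetric (M : Mechanism n A) : Prop :=
  ∀ (π : Equiv.Perm (Fin n)) (s : Fin n → A),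
    M.lottery (s ∘ π) = (M.lottery s).map (fun W => W.map π.symm.toEmbedding) ∧
      ∀ i, M.payment (s ∘ π) i = M.payment s (π i)

/-- The action profile when the agents with valuations `w` follow `σ`, except that agent `i` takes
the action `t`. -/
def deviate (σ : Fin n → ℝ → A) (i : Fin n) (t : A) (w : Fin n → ℝ) : Fin n → A :=
  Function.update (fun j => σ j (w j)) i t

/-- Expected utility of agent `i` with valuation `v` and action `t`, over the independent
valuations of the other agents (whatever is drawn for `i` itself is overwritten). -/
def interimUtility (M : Mechanism n A) (f : ℝ → ℝ) (σ : Fin n → ℝ → A) (i : Fin n)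
    (v : ℝ) (t : A) : ℝ :=
  v * (∫ w, M.alloc (deviate σ i t w) i ∂(Measure.pi fun _ => law f)) -
    ∫ w, M.payment (deviate σ i t w) i ∂(Measure.pi fun _ => law f)

/-- The expected payment of agent `i` for action `t` is finite. -/
def FinitePayment (M : Mechanism n A) (f : ℝ → ℝ) (σ : Fin n → ℝ → A) (i : Fin n)
    (t : A) : Prop :=
  Integrable (fun w => M.payment (deviate σ i t w) i) (Measure.pi fun _ => law f)

/-- `σ` is a Bayes-Nash equilibrium, ex interim individually rational, of the mechanism `M`.
Actions of infinite expected payment give utility `-∞` and are never profitable. By `normalized`,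
if `a > 0`, the lowest type has utility `0`, that is, payments are
`pᵢ(v) = v xᵢ(v) - ∫₀^v xᵢ` where `xᵢ` vanishes below `a`; for `a = 0` this is no restriction. -/
structure IsEquilibrium [MeasurableSpace A] (M : Mechanism n A) (a : ℝ) (b : EReal) (f : ℝ → ℝ)
    (σ : Fin n → ℝ → A) : Prop where
  measurable : ∀ i, Measurable (σ i)
  finite : ∀ i, ∀ v ∈ valueRange a b, M.FinitePayment f σ i (σ i v)
  best : ∀ i, ∀ v ∈ valueRange a b, ∀ t, M.FinitePayment f σ i t →
    M.interimUtility f σ i v t ≤ M.interimUtility f σ i v (σ i v)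
  rational : ∀ i, ∀ v ∈ valueRange a b, 0 ≤ M.interimUtility f σ i v (σ i v)
  normalized : 0 < a → ∀ i, M.interimUtility f σ i a (σ i a) = 0

/-- Expected residual surplus `E[∑ᵢ (vᵢ xᵢ - pᵢ)]` when the agents follow `σ`. -/
def residualSurplus (M : Mechanism n A) (f : ℝ → ℝ) (σ : Fin n → ℝ → A) : ℝ :=
  ∫ w, ∑ i, (w i * M.alloc (fun j => σ j (w j)) i - M.payment (fun j => σ j (w j)) i)
    ∂(Measure.pi fun _ => law f)

/-- `M` with the equilibrium `σ` is an optimal money-burning mechanism for `k` units: no mechanism,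
with whatever action space and in whatever equilibrium, has a larger expected residual surplus. -/
structure IsOptimal [MeasurableSpace A] (M : Mechanism n A) (k : ℕ) (a : ℝ) (b : EReal)
    (f : ℝ → ℝ) (σ : Fin n → ℝ → A) : Prop where
  feasible : M.IsFeasible k
  equilibrium : M.IsEquilibrium a b f σ
  le : ∀ (B : Type) [MeasurableSpace B] (M' : Mechanism n B) (τ : Fin n → ℝ → B),
    M'.IsFeasible k → M'.IsEquilibrium a b f τ →
      M'.residualSurplus f τ ≤ M.residualSurplus f σ

end Mechanism

/-! ### The indirect Vickrey auction -/

/-- The sets of `min k n` agents whose bids are the highest. -/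
def topSets {n : ℕ} (k : ℕ) (s : Fin n → ℝ) : Finset (Finset (Fin n)) :=
  (Finset.powersetCard (min k n) Finset.univ).filter fun W => ∀ i ∈ W, ∀ j ∉ W, s j ≤ s i

theorem topSets_nonempty {n : ℕ} (k : ℕ) (s : Fin n → ℝ) : (topSets k s).Nonempty := by
  classical
  have hne : (Finset.powersetCard (min k n) (Finset.univ : Finset (Fin n))).Nonempty := by
    rw [Finset.powersetCard_nonempty]
    simp
  obtain ⟨W, hW, hmax⟩ := Finset.exists_max_image _ (fun W => ∑ i ∈ W, s i) hne
  refine ⟨W, Finset.mem_filter.2 ⟨hW, fun i hi j hj => ?_⟩⟩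
  have hc := (Finset.mem_powersetCard.1 hW).2
  have hj' : j ∉ W.erase i := fun h => hj (Finset.mem_of_mem_erase h)
  have hpos : 0 < W.card := Finset.card_pos.2 ⟨i, hi⟩
  have h := hmax (insert j (W.erase i)) (Finset.mem_powersetCard.2 ⟨Finset.subset_univ _, by
    rw [Finset.card_insert_of_notMem hj', Finset.card_erase_of_mem hi]
    omega⟩)
  rw [Finset.sum_insert hj', ← Finset.add_sum_erase W s hi] at h
  linarith

/-- The `k` highest bids win, ties are broken uniformly at random. -/
def topLottery {n : ℕ} (k : ℕ) (s : Fin n → ℝ) : PMF (Finset (Fin n)) :=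
  PMF.uniformOfFinset (topSets k s) (topSets_nonempty k s)

/-- The probability that agent `i` is among the winners of `topLottery`. -/
def topProb {n : ℕ} (k : ℕ) (s : Fin n → ℝ) (i : Fin n) : ℝ :=
  ∑ W : Finset (Fin n) with i ∈ W, (topLottery k s W).toReal

/-- The subrange `R'` of `[a, b]` on which the ironed virtual valuation increases: the valuations
with a larger ironed virtual valuation than every lower one. From an interval on which the ironed
virtual valuation is constant only the lower end point is kept, as the common bid of this
interval. -/
def bidSpace (a : ℝ) (b : EReal) (f : ℝ → ℝ) : Set ℝ :=
  {v ∈ valueRange a b | ∀ w ∈ valueRange a b, w < v → ironedValue a b f w < ironedValue a b f v}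

/-- The largest admissible bid that does not exceed `z`. -/
def roundDown (a : ℝ) (b : EReal) (f : ℝ → ℝ) (z : ℝ) : ℝ := sSup {r ∈ bidSpace a b f | r ≤ z}

/-- The indirect `k`-unit Vickrey auction: bids are restricted to `R'`, the top `k` bids win with
uniform tie-breaking, and agent `i` pays `sᵢ xᵢ(s) - ∫ₐ^{sᵢ} xᵢ(z, s₋ᵢ) dz`, where valuation `z`
means the bid of this valuation. -/
def indirectVickrey (n k : ℕ) (a : ℝ) (b : EReal) (f : ℝ → ℝ) :
    Mechanism n (bidSpace a b f) where
  lottery s := topLottery k fun j => (s j : ℝ)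
  payment s i := (s i : ℝ) * topProb k (fun j => (s j : ℝ)) i -
    ∫ z in a..(s i : ℝ), topProb k (Function.update (fun j => (s j : ℝ)) i (roundDown a b f z)) i

end MoneyBurning

end

/-! In an equilibrium, an agent's interim winning probability `x` is a subgradient of its interim
utility, which vanishes at `a`. So the utility of type `v` is the integral of `x` over `[a, v]`. By
Tonelli its mean is the integral of `x` against `tailMeasure`, the measure with density `1 - F` on
`(a, ∞)`. The residual surplus therefore depends only on the nondecreasing functions `x`
(`Mechanism.IsEquilibrium.residualSurplus_eq`).

Ironing replaces `tailMeasure` by `ironedMeasure`, which has density `ironedValue` with respect to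
the law. On a half-line above `v` the two masses are `H 1 - H (F v)` and `G 1 - G (F v)`. Since `G ≤
H` with equality at `1`, the ironed mass is at least as large. Slicing a nondecreasing `x` into
superlevel sets, which are half-lines up to null sets, extends the inequality to integrals of `x`
(`lintegral_tailMeasure_le`). Where `G < H`, `G` is affine and `ironedValue` is constant. If `x` is
constant on level sets of `ironedValue`, the threshold of a superlevel set cannot fall there, and
the integrals agree (`lintegral_tailMeasure_eq`).

Against `ironedMeasure`, the total over agents is the expectation of the sum of winning
probabilities times ironed values (`Mechanism.sum_lintegral_ironedMeasure`). Ironed values are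
nonnegative, so serving the `k` largest is best pointwise (`sum_winProb_mul_le_topProb`). The
auction does this, because bids are ordered like ironed values, and its winning probabilities are
constant on level sets, so nothing is lost in passing back to `tailMeasure`.

That bidding `β` is an equilibrium holds ex post. The payment rule makes the utility of any bid at
most the area under the monotone winning curve up to `v`, with equality at `β(v)`, since the curve
is flat between `β(v)` and `v` (`utility_le_integral`, `utility_bidStrategy`). -/

noncomputable section

namespace MoneyBurning

open Filter Topology
open scoped ENNReal

/-! ### Right derivatives of monotone convex functions on the unit interval -/

section RightDeriv

variable {φ : ℝ → ℝ}

theorem slope_nonneg_of_monotoneOn (hm : MonotoneOn φ (Icc 0 1)) {x y : ℝ} (hx : x ∈ Icc (0 : ℝ) 1)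
    (hy : y ∈ Icc (0 : ℝ) 1) (hxy : x < y) : 0 ≤ slope φ x y := by
  rw [slope_def_field]
  exact div_nonneg (sub_nonneg.2 (hm hx hy hxy.le)) (sub_nonneg.2 hxy.le)

theorem differentiableWithinAt_Ioi_of_convexOn (hc : ConvexOn ℝ (Icc 0 1) φ)
    (hm : MonotoneOn φ (Icc 0 1)) {x : ℝ} (hx : x ∈ Ico (0 : ℝ) 1) :
    DifferentiableWithinAt ℝ φ (Ioi x) x := by
  have hx' : x ∈ Icc (0 : ℝ) 1 := ⟨hx.1, hx.2.le⟩
  have h : Ioo x 1 ⊆ {y | y ∈ Icc (0 : ℝ) 1 ∧ x < y} :=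
    fun z hz => ⟨⟨hx.1.trans hz.1.le, hz.2.le⟩, hz.1⟩
  have ht : Tendsto (slope φ x) (𝓝[>] x) (𝓝 (sInf (slope φ x '' Ioo x 1))) :=
    ((hc.monotoneOn_slope_gt hx').mono h).tendsto_nhdsWithin_Ioo_right (by simpa using hx.2)
      ⟨0, by
        rintro _ ⟨z, hz, rfl⟩
        exact slope_nonneg_of_monotoneOn hm hx' (h hz).1 hz.1⟩
  exact ((hasDerivWithinAt_iff_tendsto_slope' self_notMem_Ioi).2 ht).differentiableWithinAt

/-- Slopes towards the right end point increase but may be unbounded. The bound `hb` makes them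
converge, so that `derivWithin` at `1` is not a default value. -/
theorem differentiableWithinAt_Iio_one_of_convexOn (hc : ConvexOn ℝ (Icc 0 1) φ) {m : ℝ}
    (hb : ∀ q ∈ Icc (0 : ℝ) 1, φ 1 - φ q ≤ m * (1 - q)) :
    DifferentiableWithinAt ℝ φ (Iio 1) 1 := by
  have h1 : (1 : ℝ) ∈ Icc (0 : ℝ) 1 := by simp
  have h : Ioo (0 : ℝ) 1 ⊆ {y | y ∈ Icc (0 : ℝ) 1 ∧ y < 1} := fun z hz => ⟨⟨hz.1.le, hz.2.le⟩, hz.2⟩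
  have ht : Tendsto (slope φ 1) (𝓝[<] 1) (𝓝 (sSup (slope φ 1 '' Ioo 0 1))) :=
    ((hc.monotoneOn_slope_lt h1).mono h).tendsto_nhdsWithin_Ioo_left (by simp)
      ⟨m, by
        rintro _ ⟨z, hz, rfl⟩
        rw [slope_comm, slope_def_field, div_le_iff₀ (sub_pos.2 hz.2)]
        exact hb z (h hz).1⟩
  exact ((hasDerivWithinAt_iff_tendsto_slope' self_notMem_Iio).2 ht).differentiableWithinAt

theorem slope_le_rightDeriv (hc : ConvexOn ℝ (Icc 0 1) φ) (hm : MonotoneOn φ (Icc 0 1)) {x y : ℝ}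
    (hx : x ∈ Icc (0 : ℝ) 1) (hy : y ∈ Ico (0 : ℝ) 1) (hxy : x < y) :
    slope φ x y ≤ derivWithin φ (Ioi y) y := by
  have hd := (differentiableWithinAt_Ioi_of_convexOn hc hm hy).hasDerivWithinAt
  refine ge_of_tendsto ((hasDerivWithinAt_iff_tendsto_slope' self_notMem_Ioi).1 hd) ?_
  filter_upwards [Ioo_mem_nhdsGT hy.2] with z hz
  rw [slope_comm]
  exact hc.slope_mono ⟨hy.1, hy.2.le⟩ ⟨hx, hxy.ne⟩ ⟨⟨hy.1.trans hz.1.le, hz.2.le⟩, hz.1.ne'⟩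
    (hxy.trans hz.1).le

theorem monotoneOn_rightDeriv_Ico (hc : ConvexOn ℝ (Icc 0 1) φ) (hm : MonotoneOn φ (Icc 0 1)) :
    MonotoneOn (fun q => derivWithin φ (Ioi q) q) (Ico 0 1) := by
  intro x hx y hy hxy
  rcases hxy.eq_or_lt with rfl | hxy
  · rfl
  exact (hc.rightDeriv_le_slope ⟨hx.1, hx.2.le⟩ ⟨hy.1, hy.2.le⟩ hxy
    (differentiableWithinAt_Ioi_of_convexOn hc hm hx)).trans
    (slope_le_rightDeriv hc hm ⟨hx.1, hx.2.le⟩ hy hxy)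

theorem rightDeriv_nonneg (hm : MonotoneOn φ (Icc 0 1))
    (hc : ConvexOn ℝ (Icc 0 1) φ) {x : ℝ} (hx : x ∈ Ico (0 : ℝ) 1) :
    0 ≤ derivWithin φ (Ioi x) x := by
  have hd := (differentiableWithinAt_Ioi_of_convexOn hc hm hx).hasDerivWithinAt
  refine ge_of_tendsto ((hasDerivWithinAt_iff_tendsto_slope' self_notMem_Ioi).1 hd) ?_
  filter_upwards [Ioo_mem_nhdsGT hx.2] with z hz
  exact slope_nonneg_of_monotoneOn hm ⟨hx.1, hx.2.le⟩ ⟨hx.1.trans hz.1.le, hz.2.le⟩ hz.1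

theorem rightDeriv_le_leftDeriv_one (hc : ConvexOn ℝ (Icc 0 1) φ) (hm : MonotoneOn φ (Icc 0 1))
    {m : ℝ} (hb : ∀ q ∈ Icc (0 : ℝ) 1, φ 1 - φ q ≤ m * (1 - q)) {x : ℝ} (hx : x ∈ Ico (0 : ℝ) 1) :
    derivWithin φ (Ioi x) x ≤ derivWithin φ (Iio 1) 1 :=
  (hc.rightDeriv_le_slope ⟨hx.1, hx.2.le⟩ (by simp) hx.2
    (differentiableWithinAt_Ioi_of_convexOn hc hm hx)).trans
    (hc.slope_le_leftDeriv ⟨hx.1, hx.2.le⟩ (by simp) hx.2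
      (differentiableWithinAt_Iio_one_of_convexOn hc hb))

/-- A lower bound on the right derivative extends to the left end point of an interval. -/
theorem le_rightDeriv_of_forall_Ioo (hc : ConvexOn ℝ (Icc 0 1) φ) (hm : MonotoneOn φ (Icc 0 1))
    (hcont : ContinuousOn φ (Icc 0 1)) {x y L : ℝ} (hx : 0 ≤ x) (hxy : x < y) (hy : y ≤ 1)
    (hL : ∀ q ∈ Ioo x y, L ≤ derivWithin φ (Ioi q) q) : L ≤ derivWithin φ (Ioi x) x := by
  have hx1 : x ∈ Ico (0 : ℝ) 1 := ⟨hx, hxy.trans_le hy⟩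
  have hd := (differentiableWithinAt_Ioi_of_convexOn hc hm hx1).hasDerivWithinAt
  refine ge_of_tendsto ((hasDerivWithinAt_iff_tendsto_slope' self_notMem_Ioi).1 hd) ?_
  filter_upwards [Ioo_mem_nhdsGT hxy] with z hz
  have hz' : z ∈ Icc (0 : ℝ) 1 := ⟨hx.trans hz.1.le, hz.2.le.trans hy⟩
  have hcx : Tendsto φ (𝓝[>] x) (𝓝 (φ x)) := by
    have h := (hcont x ⟨hx, hx1.2.le⟩)
    exact h.mono_left (nhdsWithin_le_of_mem (by
      filter_upwards [Ioo_mem_nhdsGT hx1.2] with t ht using ⟨hx.trans ht.1.le, ht.2.le⟩))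
  have hid : Tendsto (fun q : ℝ => q) (𝓝[>] x) (𝓝 x) := tendsto_id.mono_left nhdsWithin_le_nhds
  have ht : Tendsto (fun q => slope φ q z) (𝓝[>] x) (𝓝 (slope φ x z)) := by
    simp only [slope_def_field]
    exact (tendsto_const_nhds.sub hcx).div (tendsto_const_nhds.sub hid) (sub_pos.2 hz.1).ne'
  refine ge_of_tendsto ht ?_
  filter_upwards [Ioo_mem_nhdsGT hz.1] with q hq
  have hq' : q ∈ Ico (0 : ℝ) 1 := ⟨hx.trans hq.1.le, hq.2.trans_le hz'.2⟩
  exact (hL q ⟨hq.1, hq.2.trans hz.2⟩).trans (hc.rightDeriv_le_slope ⟨hq'.1, hq'.2.le⟩ hz' hq.2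
    (differentiableWithinAt_Ioi_of_convexOn hc hm hq'))

theorem integrableOn_rightDeriv (hc : ConvexOn ℝ (Icc 0 1) φ) (hm : MonotoneOn φ (Icc 0 1))
    (hcont : ContinuousOn φ (Icc 0 1)) :
    IntegrableOn (fun q => derivWithin φ (Ioi q) q) (Ioc 0 1) :=
  intervalIntegral.integrableOn_deriv_right_of_nonneg hcont
    (fun _ hx => (differentiableWithinAt_Ioi_of_convexOn hc hm ⟨hx.1.le, hx.2⟩).hasDerivWithinAt)
    (fun _ hx => rightDeriv_nonneg hm hc ⟨hx.1.le, hx.2⟩)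

theorem setIntegral_rightDeriv (hc : ConvexOn ℝ (Icc 0 1) φ) (hm : MonotoneOn φ (Icc 0 1))
    (hcont : ContinuousOn φ (Icc 0 1)) {p : ℝ} (hp : p ∈ Icc (0 : ℝ) 1) :
    ∫ q in Ioc p 1, derivWithin φ (Ioi q) q = φ 1 - φ p := by
  rw [← intervalIntegral.integral_of_le hp.2]
  refine intervalIntegral.integral_eq_sub_of_hasDeriv_right_of_le hp.2
    (hcont.mono (Icc_subset_Icc_left hp.1))
    (fun x hx => (differentiableWithinAt_Ioi_of_convexOn hc hm
      ⟨hp.1.trans hx.1.le, hx.2⟩).hasDerivWithinAt) ?_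
  rw [intervalIntegrable_iff_integrableOn_Ioc_of_le hp.2]
  exact (integrableOn_rightDeriv hc hm hcont).mono_set (Ioc_subset_Ioc_left hp.1)

end RightDeriv

/-! ### The convex minorant -/

section ConvexMinorant

variable {H : ℝ → ℝ}

/-- The values of all competitors at `q` are bounded by `H q`, so the supremum is a genuine one. -/
theorem le_convexMinorant {c : ℝ → ℝ} (hc : ConvexOn ℝ (Icc 0 1) c)
    (hle : ∀ r ∈ Icc (0 : ℝ) 1, c r ≤ H r) {q : ℝ} (hq : q ∈ Icc (0 : ℝ) 1) :
    c q ≤ convexMinorant H q := by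
  refine le_csSup ⟨H q, ?_⟩ ⟨c, hc, hle, rfl⟩
  rintro _ ⟨c', -, hle', rfl⟩
  exact hle' q hq

theorem convexMinorant_le_of_forall (hH : ∀ r ∈ Icc (0 : ℝ) 1, 0 ≤ H r) {q y : ℝ}
    (h : ∀ c : ℝ → ℝ, ConvexOn ℝ (Icc 0 1) c → (∀ r ∈ Icc (0 : ℝ) 1, c r ≤ H r) → c q ≤ y) :
    convexMinorant H q ≤ y := by
  refine csSup_le ⟨0, fun _ => 0, convexOn_const 0 (convex_Icc 0 1), hH, rfl⟩ ?_
  rintro _ ⟨c, hc, hle, rfl⟩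
  exact h c hc hle

theorem convexMinorant_le (hH : ∀ r ∈ Icc (0 : ℝ) 1, 0 ≤ H r) {q : ℝ} (hq : q ∈ Icc (0 : ℝ) 1) :
    convexMinorant H q ≤ H q :=
  convexMinorant_le_of_forall hH fun _ _ hle => hle q hq

theorem convexMinorant_nonneg (hH : ∀ r ∈ Icc (0 : ℝ) 1, 0 ≤ H r) {q : ℝ}
    (hq : q ∈ Icc (0 : ℝ) 1) : 0 ≤ convexMinorant H q :=
  le_convexMinorant (convexOn_const 0 (convex_Icc 0 1)) hH hq

theorem convexOn_convexMinorant (hH : ∀ r ∈ Icc (0 : ℝ) 1, 0 ≤ H r) :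
    ConvexOn ℝ (Icc 0 1) (convexMinorant H) := by
  refine ⟨convex_Icc 0 1, fun x hx y hy s t hs ht hst => ?_⟩
  refine convexMinorant_le_of_forall hH fun c hc hle => (hc.2 hx hy hs ht hst).trans ?_
  simp only [smul_eq_mul]
  exact add_le_add (mul_le_mul_of_nonneg_left (le_convexMinorant hc hle hx) hs)
    (mul_le_mul_of_nonneg_left (le_convexMinorant hc hle hy) ht)

theorem convexMinorant_zero (hH : ∀ r ∈ Icc (0 : ℝ) 1, 0 ≤ H r) (h0 : H 0 = 0) :
    convexMinorant H 0 = 0 :=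
  le_antisymm ((convexMinorant_le hH (by simp)).trans_eq h0) (convexMinorant_nonneg hH (by simp))

/-- The minorant is convex, nonnegative and zero at `0`; write `x` as a convex combination of `0`
and `y`. This is what makes ironed values nonnegative. -/
theorem monotoneOn_convexMinorant (hH : ∀ r ∈ Icc (0 : ℝ) 1, 0 ≤ H r) (h0 : H 0 = 0) :
    MonotoneOn (convexMinorant H) (Icc 0 1) := by
  intro x hx y hy hxy
  rcases hxy.eq_or_lt with rfl | hlt
  · rfl
  have hypos : 0 < y := hx.1.trans_lt hlt
  have h := (convexOn_convexMinorant hH).2 (show (0 : ℝ) ∈ Icc (0 : ℝ) 1 by simp) hy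
    (sub_nonneg.2 ((div_le_one hypos).2 hxy)) (div_nonneg hx.1 hypos.le) (sub_add_cancel 1 (x / y))
  simp only [smul_eq_mul, mul_zero, zero_add, convexMinorant_zero hH h0] at h
  rw [div_mul_cancel₀ x hypos.ne'] at h
  exact h.trans (mul_le_of_le_one_left (convexMinorant_nonneg hH hy) ((div_le_one hypos).2 hxy))

theorem convexOn_affine (s : Set ℝ) (hs : Convex ℝ s) (m c : ℝ) :
    ConvexOn ℝ s fun q => m * q + c := by
  refine ⟨hs, fun x _ y _ s t _ _ hst => le_of_eq ?_⟩
  simp only [smul_eq_mul]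
  linear_combination (-c) * hst

theorem affine_le_convexMinorant {m c : ℝ} (hle : ∀ r ∈ Icc (0 : ℝ) 1, m * r + c ≤ H r) {q : ℝ}
    (hq : q ∈ Icc (0 : ℝ) 1) : m * q + c ≤ convexMinorant H q :=
  le_convexMinorant (convexOn_affine _ (convex_Icc 0 1) m c) hle hq

/-- Up to `ε`, a line through the right end point of the graph lies below a continuous function. -/
theorem exists_affine_le (hH : ∀ r ∈ Icc (0 : ℝ) 1, 0 ≤ H r) (hcont : ContinuousOn H (Icc 0 1))
    {ε : ℝ} (hε : 0 < ε) : ∃ m, ∀ r ∈ Icc (0 : ℝ) 1, m * r + (H 1 - ε - m) ≤ H r := by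
  have h1 : (1 : ℝ) ∈ Icc (0 : ℝ) 1 := by simp
  obtain ⟨δ, hδ, hd⟩ := Metric.continuousOn_iff.1 hcont 1 h1 ε hε
  -- Within `δ` of `1`, continuity keeps `H` above `H 1 - ε`. Farther away, this slope has already
  -- brought the line down to `-ε` or less.
  refine ⟨H 1 / δ, fun r hr => ?_⟩
  have hm : 0 ≤ H 1 / δ := div_nonneg (hH 1 h1) hδ.le
  by_cases hrd : 1 - r < δ
  · have h := hd r hr (by rw [Real.dist_eq, abs_sub_comm, abs_of_nonneg] <;> linarith [hr.2])
    rw [Real.dist_eq, abs_lt] at h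
    nlinarith [hr.2]
  · have hmul : H 1 / δ * δ = H 1 := div_mul_cancel₀ _ hδ.ne'
    nlinarith [hH r hr]

theorem convexMinorant_one (hH : ∀ r ∈ Icc (0 : ℝ) 1, 0 ≤ H r) (hcont : ContinuousOn H (Icc 0 1)) :
    convexMinorant H 1 = H 1 := by
  refine le_antisymm (convexMinorant_le hH (by simp)) (le_of_forall_pos_le_add fun ε hε => ?_)
  obtain ⟨m, hm⟩ := exists_affine_le hH hcont hε
  have := affine_le_convexMinorant hm (show (1 : ℝ) ∈ Icc (0 : ℝ) 1 by simp)
  linarith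

/-- Convexity gives continuity in the interior only. At `0` the minorant is squeezed between `0` and
`H`, at `1` between affine minorants and `H`. -/
theorem continuousOn_convexMinorant (hH : ∀ r ∈ Icc (0 : ℝ) 1, 0 ≤ H r) (h0 : H 0 = 0)
    (hcont : ContinuousOn H (Icc 0 1)) : ContinuousOn (convexMinorant H) (Icc 0 1) := by
  intro x hx
  rcases hx.1.eq_or_lt with rfl | hx0
  · have hz := hcont 0 hx
    unfold ContinuousWithinAt at hz ⊢
    rw [convexMinorant_zero hH h0]
    rw [h0] at hz
    refine tendsto_of_tendsto_of_tendsto_of_le_of_le' tendsto_const_nhds hz ?_ ?_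
    · filter_upwards [self_mem_nhdsWithin] with q hq using convexMinorant_nonneg hH hq
    · filter_upwards [self_mem_nhdsWithin] with q hq using convexMinorant_le hH hq
  rcases hx.2.eq_or_lt with rfl | hx1
  · have hz := hcont 1 hx
    unfold ContinuousWithinAt at hz ⊢
    rw [convexMinorant_one hH hcont]
    refine tendsto_order.2 ⟨fun y hy => ?_, fun y hy => ?_⟩
    · obtain ⟨m, hm⟩ := exists_affine_le hH hcont (ε := (H 1 - y) / 2) (by linarith)
      have ht : Tendsto (fun q => m * q + (H 1 - (H 1 - y) / 2 - m)) (𝓝[Icc 0 1] 1)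
          (𝓝 (m * 1 + (H 1 - (H 1 - y) / 2 - m))) :=
        (Continuous.tendsto (by fun_prop) 1).mono_left nhdsWithin_le_nhds
      filter_upwards [self_mem_nhdsWithin, ht.eventually_const_lt (by linarith : y < _)]
        with q hq hlt using hlt.trans_le (affine_le_convexMinorant hm hq)
    · filter_upwards [self_mem_nhdsWithin, hz.eventually_lt_const hy] with q hq hlt
        using (convexMinorant_le hH hq).trans_lt hlt
  · have h := (convexOn_convexMinorant hH).continuousOn_interior
    rw [interior_Icc] at h
    exact (h.continuousAt (Ioo_mem_nhds hx0 hx1)).continuousWithinAt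

/-- Where the convex minorant is strictly below the function it is affine. -/
theorem rightDeriv_convexMinorant_eq (hH : ∀ r ∈ Icc (0 : ℝ) 1, 0 ≤ H r) (h0 : H 0 = 0)
    (hcont : ContinuousOn H (Icc 0 1)) {q : ℝ} (hq : q ∈ Ioo (0 : ℝ) 1)
    (hlt : convexMinorant H q < H q) : ∃ x ∈ Ioo (0 : ℝ) q, ∃ y ∈ Ioo q 1,
      ∀ p ∈ Ico x y, derivWithin (convexMinorant H) (Ioi p) p = slope (convexMinorant H) x y := by
  set G := convexMinorant H with hG
  have hGconv : ConvexOn ℝ (Icc 0 1) G := convexOn_convexMinorant hH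
  -- A constant level `M` separates `G` from `H` on a whole interval `[x, y]` around `q`.
  obtain ⟨M, hM1, hM2⟩ := exists_between hlt
  have hnhds : Icc (0 : ℝ) 1 ∈ 𝓝 q := Icc_mem_nhds hq.1 hq.2
  have hHq : ∀ᶠ r in 𝓝 q, M < H r :=
    (hcont.continuousAt hnhds).eventually_const_lt hM2
  have hGq : ∀ᶠ r in 𝓝 q, G r < M :=
    ((continuousOn_convexMinorant hH h0 hcont).continuousAt hnhds).eventually_lt_const hM1
  obtain ⟨l, u, hlu, hsub⟩ := mem_nhds_iff_exists_Ioo_subset.1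
    (hHq.and (hGq.and (Ioo_mem_nhds hq.1 hq.2)))
  obtain ⟨x, hlx, hxq⟩ := exists_between hlu.1
  obtain ⟨y, hqy, hyu⟩ := exists_between hlu.2
  have hxy : x < y := hxq.trans hqy
  have hin : ∀ r ∈ Icc x y, M < H r ∧ G r < M ∧ r ∈ Ioo (0 : ℝ) 1 := fun r hr =>
    hsub ⟨hlx.trans_le hr.1, hr.2.trans_lt hyu⟩
  have hx := hin x ⟨le_rfl, hxy.le⟩
  have hy := hin y ⟨hxy.le, le_rfl⟩
  have hxI : x ∈ Icc (0 : ℝ) 1 := Ioo_subset_Icc_self hx.2.2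
  have hyI : y ∈ Icc (0 : ℝ) 1 := Ioo_subset_Icc_self hy.2.2
  set m := slope G x y with hm
  have hmy : m * (y - x) = G y - G x := by
    rw [hm, slope_def_field, div_mul_cancel₀ _ (sub_pos.2 hxy).ne']
  have hinL : ∀ r ∈ Icc x y, m * r + (G x - m * x) ≤ M := by
    intro r hr
    rcases le_total 0 m with h | h <;> nlinarith [hr.1, hr.2, hx.2.1, hy.2.1]
  have houtL : ∀ r ∈ Icc (0 : ℝ) 1, r ∉ Icc x y → m * r + (G x - m * x) ≤ G r := by
    intro r hr hrn
    rcases lt_or_ge r x with hrx | hrx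
    · have h := hGconv.slope_mono hxI ⟨hr, hrx.ne⟩ ⟨hyI, hxy.ne'⟩ (hrx.trans hxy).le
      rw [slope_comm, slope_def_field, div_le_iff₀ (sub_pos.2 hrx)] at h
      linarith
    · have hyr : y < r := not_le.1 fun h => hrn ⟨hrx, h⟩
      have h := hGconv.slope_mono hxI ⟨hyI, hxy.ne'⟩ ⟨hr, (hxy.trans hyr).ne'⟩ hyr.le
      rw [← hm, slope_def_field, le_div_iff₀ (sub_pos.2 (hxy.trans hyr))] at h
      linarith
  -- The maximum of `G` and the chord over `[x, y]` is convex. It stays below `H`: inside, the chord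
  -- is at most `M`; outside, it is at most `G`. By maximality of `G` the chord then lies below `G`,
  -- so the two coincide on `[x, y]`.
  have hmax : ∀ r ∈ Icc (0 : ℝ) 1, (G ⊔ fun q => m * q + (G x - m * x)) r ≤ H r := by
    intro r hr
    refine sup_le (convexMinorant_le hH hr) ?_
    by_cases hrI : r ∈ Icc x y
    · exact (hinL r hrI).trans (hin r hrI).1.le
    · exact (houtL r hr hrI).trans (convexMinorant_le hH hr)
  have hGL : ∀ r ∈ Icc x y, G r = m * r + (G x - m * x) := by
    intro r hr
    have hrI : r ∈ Icc (0 : ℝ) 1 := Ioo_subset_Icc_self (hin r hr).2.2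
    refine le_antisymm ?_ ?_
    · rcases hr.1.eq_or_lt with rfl | hxr
      · linarith
      have h := hGconv.slope_mono hxI ⟨hrI, hxr.ne'⟩ ⟨hyI, hxy.ne'⟩ hr.2
      rw [← hm, slope_def_field, div_le_iff₀ (sub_pos.2 hxr)] at h
      linarith
    · exact le_sup_right.trans
        (le_convexMinorant (hGconv.sup (convexOn_affine _ (convex_Icc 0 1) _ _)) hmax hrI)
  refine ⟨x, ⟨hx.2.2.1, hxq⟩, y, ⟨hqy, hy.2.2.2⟩, fun p hp => ?_⟩
  have hd : HasDerivWithinAt (fun q => m * q + (G x - m * x)) m (Ioi p) p := by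
    simpa using (((hasDerivAt_id p).const_mul m).add_const (G x - m * x)).hasDerivWithinAt
  refine HasDerivWithinAt.derivWithin ?_ (uniqueDiffWithinAt_Ioi p)
  refine hd.congr_of_eventuallyEq ?_ (hGL p ⟨hp.1, hp.2.le⟩)
  filter_upwards [Ioo_mem_nhdsGT hp.2] with r hr using hGL r ⟨hp.1.trans hr.1.le, hr.2.le⟩

end ConvexMinorant

/-! ### The distribution of valuations -/

theorem measurableSet_valueRange (a : ℝ) (b : EReal) : MeasurableSet (valueRange a b) :=
  measurableSet_Ici.inter (measurable_coe_real_ereal measurableSet_Iic)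

theorem mem_valueRange_of_le {a : ℝ} {b : EReal} {v w : ℝ} (hv : v ∈ valueRange a b) (haw : a ≤ w)
    (hwv : w ≤ v) : w ∈ valueRange a b :=
  ⟨haw, (EReal.coe_le_coe_iff.2 hwv).trans hv.2⟩

theorem left_mem_valueRange {a : ℝ} {b : EReal} (hab : (a : EReal) < b) : a ∈ valueRange a b :=
  ⟨le_rfl, hab.le⟩

theorem monotone_F (f : ℝ → ℝ) : Monotone (F f) := monotone_cdf _

theorem F_nonneg (f : ℝ → ℝ) (z : ℝ) : 0 ≤ F f z := cdf_nonneg _ _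

theorem F_le_one (f : ℝ → ℝ) (z : ℝ) : F f z ≤ 1 := cdf_le_one _ _

theorem measurable_F (f : ℝ → ℝ) : Measurable (F f) := (monotone_F f).measurable

instance nullSingletonClass_law (f : ℝ → ℝ) : NullSingletonClass (law f) :=
  ⟨fun x => withDensity_absolutelyContinuous _ _ (measure_singleton x)⟩

namespace IsValuationDensity

variable {a : ℝ} {b : EReal} {f : ℝ → ℝ}

theorem nonneg (hf : IsValuationDensity a b f) (v : ℝ) : 0 ≤ f v := by
  by_cases hv : v ∈ valueRange a b
  · exact (hf.pos v hv).le
  · exact (hf.zero v hv).ge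

theorem law_compl_valueRange (hf : IsValuationDensity a b f) : law f (valueRange a b)ᶜ = 0 := by
  rw [law, withDensity_apply _ (measurableSet_valueRange a b).compl]
  refine (setLIntegral_congr_fun (measurableSet_valueRange a b).compl fun v hv => ?_).trans
    lintegral_zero
  simp [hf.zero v hv]

theorem ae_mem_valueRange (hf : IsValuationDensity a b f) : ∀ᵐ v ∂law f, v ∈ valueRange a b :=
  hf.law_compl_valueRange

theorem law_Iic (hf : IsValuationDensity a b f) (z : ℝ) :
    law f (Iic z) = ENNReal.ofReal (F f z) := by
  have := hf.isProbability
  exact (ofReal_cdf _ _).symm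

theorem law_Ioi (hf : IsValuationDensity a b f) (z : ℝ) :
    law f (Ioi z) = ENNReal.ofReal (1 - F f z) := by
  have := hf.isProbability
  rw [← compl_Iic, measure_compl measurableSet_Iic (measure_ne_top _ _), measure_univ, hf.law_Iic,
    ENNReal.ofReal_sub _ (F_nonneg f z), ENNReal.ofReal_one]

/-- The law has no atoms, so the jump of `F` at each point is zero. -/
theorem continuous_F (hf : IsValuationDensity a b f) : Continuous (F f) := by
  have := hf.isProbability
  refine continuous_iff_continuousAt.2 fun x => ?_
  have h := (cdf (law f)).measure_singleton x
  rw [measure_cdf, measure_singleton, eq_comm, ENNReal.ofReal_eq_zero] at h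
  refine (monotone_F f).continuousAt_iff_leftLim_eq_rightLim.2 ?_
  have hr : Function.rightLim (F f) x = F f x := (cdf (law f)).rightLim_eq x
  rw [hr]
  exact le_antisymm ((monotone_F f).leftLim_le le_rfl) (sub_nonpos.1 h)

theorem F_left (hf : IsValuationDensity a b f) : F f a = 0 := by
  have h : law f (Iic a) = 0 := by
    rw [← Iio_union_right]
    have hsub : Iio a ⊆ (valueRange a b)ᶜ := fun x hx hxR => not_le.2 hx hxR.1
    exact measure_union_null (measure_mono_null hsub hf.law_compl_valueRange) (measure_singleton a)
  rw [hf.law_Iic, ENNReal.ofReal_eq_zero] at h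
  exact le_antisymm h (F_nonneg f a)

theorem law_Ioi_of_le (hf : IsValuationDensity a b f) {z : ℝ} (hz : b ≤ z) : law f (Ioi z) = 0 := by
  have hsub : Ioi z ⊆ (valueRange a b)ᶜ := fun x hx hxR =>
    not_le.2 (EReal.coe_lt_coe_iff.2 hx) (hxR.2.trans hz)
  exact measure_mono_null hsub hf.law_compl_valueRange

theorem F_eq_one_of_le (hf : IsValuationDensity a b f) {z : ℝ} (hz : b ≤ z) : F f z = 1 := by
  have h := hf.law_Ioi_of_le hz
  rw [hf.law_Ioi, ENNReal.ofReal_eq_zero] at h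
  linarith [F_le_one f z]

theorem F_eq_one_of_notMem (hf : IsValuationDensity a b f) {z : ℝ} (haz : a ≤ z)
    (hz : z ∉ valueRange a b) : F f z = 1 :=
  hf.F_eq_one_of_le (not_le.1 fun h => hz ⟨haz, h⟩).le

theorem strictMonoOn_F (hf : IsValuationDensity a b f) : StrictMonoOn (F f) (valueRange a b) := by
  intro v hv w hw hvw
  have := hf.isProbability
  have hpos : 0 < law f (Ioc v w) := by
    rw [law, withDensity_apply _ measurableSet_Ioc,
      setLIntegral_pos_iff hf.measurable.ennreal_ofReal]
    have hsub : Ioc v w ⊆ Function.support (fun x => ENNReal.ofReal (f x)) ∩ Ioc v w := by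
      refine fun x hx => ⟨?_, hx⟩
      have := hf.pos x (mem_valueRange_of_le hw (hv.1.trans hx.1.le) hx.2)
      simpa using this
    refine lt_of_lt_of_le ?_ (measure_mono hsub)
    simpa using hvw
  rw [← Iic_sdiff_Iic, measure_sdiff (Iic_subset_Iic.2 hvw.le) nullMeasurableSet_Iic
    (measure_ne_top _ _), hf.law_Iic, hf.law_Iic, ← ENNReal.ofReal_sub _ (F_nonneg f v),
    ENNReal.ofReal_pos] at hpos
  linarith

/-- Intermediate value theorem. The level `1` is excluded because it is not attained when `b = ∞`.
-/
theorem exists_F_eq (hf : IsValuationDensity a b f) {q : ℝ} (hq : q ∈ Ico (0 : ℝ) 1) :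
    ∃ v ∈ valueRange a b, F f v = q := by
  have := hf.isProbability
  obtain ⟨z, hz⟩ := ((tendsto_cdf_atTop (law f)).eventually_const_lt hq.2).exists
  have haz : a ≤ z := by
    by_contra! h
    have := monotone_F f h.le
    rw [hf.F_left] at this
    exact absurd (hz.trans_le this) (not_lt.2 hq.1)
  obtain ⟨v, hv, hvq⟩ := intermediate_value_Icc haz hf.continuous_F.continuousOn
    (show q ∈ Icc (F f a) (F f z) from ⟨hf.F_left.symm ▸ hq.1, hz.le⟩)
  refine ⟨v, ?_, hvq⟩
  by_contra hvR
  exact hq.2.ne (hvq ▸ hf.F_eq_one_of_notMem hv.1 hvR)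

/-- Probability integral transform: for `q = F v`, strict monotonicity on the range identifies `{F ≤
q}` with `Iic v` almost surely. -/
theorem map_F_law (hf : IsValuationDensity a b f) :
    (law f).map (F f) = volume.restrict (Ioc 0 1) := by
  have := hf.isProbability
  have := Measure.isProbabilityMeasure_map (μ := law f) (measurable_F f).aemeasurable
  refine Measure.ext_of_Iic _ _ fun q => ?_
  rw [Measure.map_apply (measurable_F f) measurableSet_Iic,
    Measure.restrict_apply measurableSet_Iic]
  rcases lt_or_ge q 0 with hq0 | hq0
  · have h1 : F f ⁻¹' Iic q = ∅ :=
      eq_empty_of_forall_notMem fun x hx => not_le.2 hq0 ((F_nonneg f x).trans hx)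
    have h2 : Iic q ∩ Ioc (0 : ℝ) 1 = ∅ :=
      eq_empty_of_forall_notMem fun x hx => not_le.2 hq0 (hx.2.1.le.trans hx.1)
    rw [h1, h2, measure_empty, measure_empty]
  rcases lt_or_ge q 1 with hq1 | hq1
  · obtain ⟨v, hv, rfl⟩ := hf.exists_F_eq ⟨hq0, hq1⟩
    have h2 : Iic (F f v) ∩ Ioc (0 : ℝ) 1 = Ioc 0 (F f v) := by
      ext x
      simp only [mem_inter_iff, mem_Iic, mem_Ioc]
      exact ⟨fun h => ⟨h.2.1, h.1⟩, fun h => ⟨h.2, h.1, h.2.trans hq1.le⟩⟩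
    rw [h2, Real.volume_Ioc, sub_zero, ← hf.law_Iic]
    refine measure_congr ?_
    filter_upwards [hf.ae_mem_valueRange] with x hx
    exact propext (hf.strictMonoOn_F.le_iff_le hx hv)
  · have h1 : F f ⁻¹' Iic q = univ := eq_univ_of_forall fun x => (F_le_one f x).trans hq1
    have h2 : Iic q ∩ Ioc (0 : ℝ) 1 = Ioc 0 1 :=
      inter_eq_right.2 fun x hx => hx.2.trans hq1
    rw [h1, h2]
    simp

end IsValuationDensity

/-! ### The tail measure -/

/-- The measure with density `1 - F` on `(a, ∞)`. -/
def tailMeasure (a : ℝ) (f : ℝ → ℝ) : Measure ℝ :=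
  (volume.restrict (Ioi a)).withDensity fun z => law f (Ioi z)

theorem measurable_law_Ioi (f : ℝ → ℝ) : Measurable fun z => law f (Ioi z) :=
  Antitone.measurable fun _ _ h => measure_mono (Ioi_subset_Ioi h)

namespace IsValuationDensity

variable {a : ℝ} {b : EReal} {f : ℝ → ℝ}

theorem tailMeasure_absolutelyContinuous : tailMeasure a f ≪ volume :=
  (withDensity_absolutelyContinuous _ _).trans Measure.absolutelyContinuous_restrict

/-- Tonelli on the region `a < z ≤ v`: for fixed `z`, the valuations `v ≥ z` have mass `1 - F z`. -/
theorem lintegral_tailMeasure (hf : IsValuationDensity a b f) {X : ℝ → ℝ≥0∞} (hX : Measurable X) :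
    ∫⁻ z, X z ∂tailMeasure a f = ∫⁻ v, (∫⁻ z in Ioc a v, X z) ∂law f := by
  have := hf.isProbability
  have hm : Measurable (fun p : ℝ × ℝ => if p.2 ≤ p.1 then X p.2 else 0) :=
    Measurable.ite (measurableSet_le measurable_snd measurable_fst) (hX.comp measurable_snd)
      measurable_const
  have h1 : ∀ v, ∫⁻ z in Ioc a v, X z = ∫⁻ z in Ioi a, if z ≤ v then X z else 0 := by
    intro v
    have : (fun z => if z ≤ v then X z else 0) = (Iic v).indicator X := by
      ext z; simp [indicator_apply]
    rw [this, lintegral_indicator measurableSet_Iic, Measure.restrict_restrict measurableSet_Iic,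
      inter_comm, Ioi_inter_Iic]
  simp_rw [h1]
  rw [lintegral_lintegral_swap hm.aemeasurable, tailMeasure,
    lintegral_withDensity_eq_lintegral_mul _ (measurable_law_Ioi f) hX]
  refine lintegral_congr fun z => ?_
  have : (fun v => if z ≤ v then X z else 0) = (Ici z).indicator fun _ => X z := by
    ext v; simp [indicator_apply]
  rw [this, lintegral_indicator measurableSet_Ici, setLIntegral_const, measure_congr Ioi_ae_eq_Ici.symm,
    Pi.mul_apply, mul_comm]

/-- The total mass is the mean of `v - a`; finiteness of the mean enters here. -/
theorem isFiniteMeasure_tailMeasure (hf : IsValuationDensity a b f) :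
    IsFiniteMeasure (tailMeasure a f) := by
  have := hf.isProbability
  refine ⟨?_⟩
  rw [← lintegral_one, hf.lintegral_tailMeasure measurable_const]
  simp only [lintegral_one, Measure.restrict_apply_univ, Real.volume_Ioc]
  exact (hf.mean.sub (integrable_const a)).lintegral_lt_top

theorem ae_tailMeasure (hf : IsValuationDensity a b f) :
    ∀ᵐ z ∂tailMeasure a f, z ∈ valueRange a b ∧ a < z := by
  have hm : MeasurableSet {z | z ∈ valueRange a b ∧ a < z} :=
    (measurableSet_valueRange a b).inter measurableSet_Ioi
  change tailMeasure a f {z | z ∈ valueRange a b ∧ a < z}ᶜ = 0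
  rw [tailMeasure, withDensity_apply _ hm.compl, Measure.restrict_restrict hm.compl]
  refine (setLIntegral_congr_fun (hm.compl.inter measurableSet_Ioi) fun z hz => ?_).trans
    lintegral_zero
  exact hf.law_Ioi_of_le (not_le.1 fun h => hz.1 ⟨⟨le_of_lt hz.2, h⟩, hz.2⟩).le

/-! ### The function `H` -/

theorem virtualValue_nonneg (hf : IsValuationDensity a b f) (v : ℝ) : 0 ≤ virtualValue f v :=
  div_nonneg (sub_nonneg.2 (F_le_one f v)) (hf.nonneg v)

theorem measurable_virtualValue (hf : IsValuationDensity a b f) : Measurable (virtualValue f) :=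
  (measurable_const.sub (measurable_F f)).div hf.measurable

theorem quantile_F (hf : IsValuationDensity a b f) {v : ℝ} (hv : v ∈ valueRange a b) :
    quantile a b f (F f v) = v := by
  have h : IsLeast {z ∈ valueRange a b | F f v ≤ F f z} v :=
    ⟨⟨hv, le_rfl⟩, fun z hz => (hf.strictMonoOn_F.le_iff_le hv hz.1).1 hz.2⟩
  exact h.csInf_eq

theorem aemeasurable_hFun (hf : IsValuationDensity a b f) :
    AEMeasurable (hFun a b f) (volume.restrict (Ioc 0 1)) := by
  refine hf.measurable_virtualValue.comp_aemeasurable ?_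
  rw [← Measure.restrict_congr_set Ioo_ae_eq_Ioc]
  refine aemeasurable_restrict_of_monotoneOn measurableSet_Ioo fun q hq r hr hqr => ?_
  obtain ⟨v, hv, rfl⟩ := hf.exists_F_eq ⟨hq.1.le, hq.2⟩
  obtain ⟨w, hw, rfl⟩ := hf.exists_F_eq ⟨hr.1.le, hr.2⟩
  rw [hf.quantile_F hv, hf.quantile_F hw]
  exact (hf.strictMonoOn_F.le_iff_le hv hw).1 hqr

theorem hFun_nonneg (hf : IsValuationDensity a b f) (q : ℝ) : 0 ≤ hFun a b f q :=
  hf.virtualValue_nonneg _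

/-- Substitute `q = F v`: the integrand becomes the virtual value times the density `f`, which is `1
- F`. This expresses `H` through `tailMeasure`. -/
theorem setLIntegral_hFun (hf : IsValuationDensity a b f) {S : Set ℝ} (hS : MeasurableSet S) :
    ∫⁻ r in S ∩ Ioc 0 1, ENNReal.ofReal (hFun a b f r) = tailMeasure a f (F f ⁻¹' S) := by
  have hS' : MeasurableSet (F f ⁻¹' S) := measurable_F f hS
  rw [← Measure.restrict_restrict hS, ← lintegral_indicator hS, ← hf.map_F_law, lintegral_map' _
    (measurable_F f).aemeasurable, tailMeasure, withDensity_apply _ hS',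
    Measure.restrict_restrict hS', ← lintegral_indicator (hS'.inter measurableSet_Ioi)]
  · have h : (fun v => S.indicator (fun r => ENNReal.ofReal (hFun a b f r)) (F f v)) =ᵐ[law f]
        (F f ⁻¹' S).indicator fun v => ENNReal.ofReal (virtualValue f v) := by
      filter_upwards [hf.ae_mem_valueRange] with v hv
      by_cases hvS : F f v ∈ S
      · rw [indicator_of_mem hvS, indicator_of_mem (show v ∈ F f ⁻¹' S from hvS), hFun,
          hf.quantile_F hv]
      · rw [indicator_of_notMem hvS, indicator_of_notMem (show v ∉ F f ⁻¹' S from hvS)]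
    rw [lintegral_congr_ae h, law, lintegral_withDensity_eq_lintegral_mul _
      hf.measurable.ennreal_ofReal (hf.measurable_virtualValue.ennreal_ofReal.indicator hS')]
    have hne : ∀ᵐ v : ℝ, v ≠ a := by simp [ae_iff]
    refine lintegral_congr_ae ?_
    filter_upwards [hne] with v hva
    rw [Pi.mul_apply, ← law]
    by_cases hvR : v ∈ valueRange a b
    · have hav : a < v := lt_of_le_of_ne hvR.1 hva.symm
      by_cases hvS : v ∈ F f ⁻¹' S
      · rw [indicator_of_mem hvS, indicator_of_mem (show v ∈ F f ⁻¹' S ∩ Ioi a from ⟨hvS, hav⟩), hf.law_Ioi, ← ENNReal.ofReal_mul (hf.nonneg v),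
          virtualValue, mul_div_cancel₀ _ (hf.pos v hvR).ne']
      · rw [indicator_of_notMem hvS, indicator_of_notMem fun h => hvS h.1, mul_zero]
    · rw [hf.zero v hvR, ENNReal.ofReal_zero, zero_mul]
      refine (indicator_apply_eq_zero.2 fun h => ?_).symm
      exact hf.law_Ioi_of_le (not_le.1 fun hb => hvR ⟨le_of_lt h.2, hb⟩).le
  · rw [hf.map_F_law]
    exact hf.aemeasurable_hFun.ennreal_ofReal.indicator hS

theorem integrableOn_hFun (hf : IsValuationDensity a b f) :
    IntegrableOn (hFun a b f) (Ioc 0 1) := by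
  have := hf.isFiniteMeasure_tailMeasure
  refine ⟨hf.aemeasurable_hFun.aestronglyMeasurable, ?_⟩
  rw [hasFiniteIntegral_iff_ofReal (Eventually.of_forall hf.hFun_nonneg)]
  have h := hf.setLIntegral_hFun MeasurableSet.univ
  rw [univ_inter] at h
  rw [h]
  exact measure_lt_top _ _

theorem HFun_eq (hf : IsValuationDensity a b f) {q : ℝ} (hq : q ∈ Icc (0 : ℝ) 1) :
    HFun a b f q = (tailMeasure a f).real (F f ⁻¹' Ioc 0 q) := by
  have hs : Ioc 0 q ∩ Ioc (0 : ℝ) 1 = Ioc 0 q := inter_eq_left.2 (Ioc_subset_Ioc_right hq.2)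
  rw [HFun, intervalIntegral.integral_of_le hq.1, measureReal_def,
    ← hf.setLIntegral_hFun measurableSet_Ioc, hs,
    integral_eq_lintegral_of_nonneg_ae (Eventually.of_forall hf.hFun_nonneg)]
  exact (hf.aemeasurable_hFun.mono_measure
    (Measure.restrict_mono (Ioc_subset_Ioc_right hq.2) le_rfl)).aestronglyMeasurable

theorem HFun_nonneg (hf : IsValuationDensity a b f) {q : ℝ} (hq : q ∈ Icc (0 : ℝ) 1) :
    0 ≤ HFun a b f q := by
  rw [hf.HFun_eq hq]
  exact measureReal_nonneg

theorem continuousOn_HFun (hf : IsValuationDensity a b f) : ContinuousOn (HFun a b f) (Icc 0 1) := by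
  have h := intervalIntegral.continuousOn_primitive_interval (f := hFun a b f) (μ := volume)
    (a := 0) (b := 1) (by
      rw [uIcc_of_le zero_le_one, integrableOn_Icc_iff_integrableOn_Ioc]
      exact hf.integrableOn_hFun)
  rwa [uIcc_of_le zero_le_one] at h

theorem HFun_one_sub (hf : IsValuationDensity a b f) {v : ℝ} (hv : v ∈ valueRange a b) :
    HFun a b f 1 - HFun a b f (F f v) = (tailMeasure a f).real (Ioi v) := by
  have := hf.isFiniteMeasure_tailMeasure
  rw [hf.HFun_eq ⟨zero_le_one, le_rfl⟩, hf.HFun_eq ⟨F_nonneg f v, F_le_one f v⟩,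
    ← measureReal_sdiff (preimage_mono (Ioc_subset_Ioc_right (F_le_one f v)))
      (measurable_F f measurableSet_Ioc)]
  refine measureReal_congr ?_
  filter_upwards [hf.ae_tailMeasure] with z hz
  refine propext ?_
  change (F f z ∈ Ioc 0 1 ∧ ¬ F f z ∈ Ioc 0 (F f v)) ↔ v < z
  rw [← hf.strictMonoOn_F.lt_iff_lt hv hz.1]
  simp only [mem_Ioc, not_and, not_le]
  refine ⟨fun h => h.2 h.1.1, fun h => ⟨⟨(F_nonneg f v).trans_lt h, F_le_one f z⟩, fun _ => h⟩⟩

/-- The mean residual life is bounded if the range is. -/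
theorem HFun_one_sub_le (hf : IsValuationDensity a b f) {u : ℝ} (hu : u ∈ valueRange a b)
    (hbu : b = u) {q : ℝ} (hq : q ∈ Icc (0 : ℝ) 1) :
    HFun a b f 1 - HFun a b f q ≤ (u - a) * (1 - q) := by
  rcases hq.2.eq_or_lt with rfl | hq1
  · simp
  obtain ⟨v, hv, rfl⟩ := hf.exists_F_eq ⟨hq.1, hq1⟩
  have hvu : v ≤ u := EReal.coe_le_coe_iff.1 (hbu ▸ hv.2)
  rw [hf.HFun_one_sub hv]
  refine ENNReal.toReal_le_of_le_ofReal
    (mul_nonneg (sub_nonneg.2 hu.1) (sub_nonneg.2 (F_le_one f v))) ?_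
  rw [tailMeasure, withDensity_apply _ measurableSet_Ioi, Measure.restrict_restrict measurableSet_Ioi,
    inter_eq_left.2 (Ioi_subset_Ioi hv.1)]
  calc ∫⁻ z in Ioi v, law f (Ioi z)
      ≤ ∫⁻ z in Ioi v, (Iic u).indicator (fun _ => law f (Ioi v)) z := by
        refine setLIntegral_mono' measurableSet_Ioi fun z hz => ?_
        by_cases hzu : z ≤ u
        · rw [indicator_of_mem (show z ∈ Iic u from hzu)]
          exact measure_mono (Ioi_subset_Ioi (le_of_lt hz))
        · rw [hf.law_Ioi_of_le (hbu ▸ EReal.coe_le_coe_iff.2 (not_le.1 hzu).le)]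
          exact zero_le
    _ = law f (Ioi v) * ENNReal.ofReal (u - v) := by
        rw [lintegral_indicator measurableSet_Iic, Measure.restrict_restrict measurableSet_Iic,
          setLIntegral_const, inter_comm, Ioi_inter_Iic, Real.volume_Ioc]
    _ ≤ ENNReal.ofReal ((u - a) * (1 - F f v)) := by
        rw [hf.law_Ioi, ← ENNReal.ofReal_mul (sub_nonneg.2 (F_le_one f v))]
        refine ENNReal.ofReal_le_ofReal ?_
        nlinarith [hv.1, F_le_one f v]

end IsValuationDensity

/-! ### Ironing -/

namespace IsValuationDensity

variable {a : ℝ} {b : EReal} {f : ℝ → ℝ}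

theorem HFun_zero : HFun a b f 0 = 0 := intervalIntegral.integral_same

theorem convexOn_GFun (hf : IsValuationDensity a b f) : ConvexOn ℝ (Icc 0 1) (GFun a b f) :=
  convexOn_convexMinorant fun _ => hf.HFun_nonneg

theorem monotoneOn_GFun (hf : IsValuationDensity a b f) : MonotoneOn (GFun a b f) (Icc 0 1) :=
  monotoneOn_convexMinorant (fun _ => hf.HFun_nonneg) HFun_zero

theorem continuousOn_GFun (hf : IsValuationDensity a b f) : ContinuousOn (GFun a b f) (Icc 0 1) :=
  continuousOn_convexMinorant (fun _ => hf.HFun_nonneg) HFun_zero hf.continuousOn_HFun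

theorem GFun_one (hf : IsValuationDensity a b f) : GFun a b f 1 = HFun a b f 1 :=
  convexMinorant_one (fun _ => hf.HFun_nonneg) hf.continuousOn_HFun

theorem GFun_le_HFun (hf : IsValuationDensity a b f) {q : ℝ} (hq : q ∈ Icc (0 : ℝ) 1) :
    GFun a b f q ≤ HFun a b f q :=
  convexMinorant_le (fun _ => hf.HFun_nonneg) hq

/-- The line of slope `u - a` through the right end point of the graph lies below `H`, hence below
`G`. This bounds the slopes of `G` at `1`, as its left derivative there requires. -/
theorem GFun_one_sub_le (hf : IsValuationDensity a b f) {u : ℝ} (hu : u ∈ valueRange a b)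
    (hbu : b = u) {q : ℝ} (hq : q ∈ Icc (0 : ℝ) 1) :
    GFun a b f 1 - GFun a b f q ≤ (u - a) * (1 - q) := by
  have h := affine_le_convexMinorant (H := HFun a b f) (m := u - a) (c := HFun a b f 1 - (u - a))
    (fun r hr => by linarith [hf.HFun_one_sub_le hu hbu hr]) hq
  rw [hf.GFun_one, GFun]
  linarith

theorem gFun_of_lt {q : ℝ} (hq : q < 1) :
    gFun a b f q = derivWithin (GFun a b f) (Ioi q) q := if_pos hq

theorem eq_of_F_eq_one (hf : IsValuationDensity a b f) {w : ℝ} (hw : w ∈ valueRange a b)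
    (h1 : F f w = 1) : b = w := by
  refine le_antisymm (not_lt.1 fun hwb => ?_) hw.2
  obtain ⟨x, hwx, hxb⟩ := EReal.lt_iff_exists_real_btwn.1 hwb
  have hwx' := EReal.coe_lt_coe_iff.1 hwx
  have h := hf.strictMonoOn_F hw (⟨hw.1.trans hwx'.le, hxb.le⟩ : x ∈ valueRange a b) hwx'
  linarith [F_le_one f x]

/-- Right derivatives of a convex function increase. The left derivative at `1` is used only if `F w
= 1` for some `w` in the range; then `b = w` is finite and that derivative exists. -/
theorem monotoneOn_ironedValue (hf : IsValuationDensity a b f) :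
    MonotoneOn (ironedValue a b f) (valueRange a b) := by
  intro v hv w hw hvw
  have hF := monotone_F f hvw
  rcases (F_le_one f w).eq_or_lt with hw1 | hw1
  · rcases (F_le_one f v).eq_or_lt with hv1 | hv1
    · rw [ironedValue, ironedValue, hv1, hw1]
    · rw [ironedValue, ironedValue, hw1, gFun_of_lt hv1, gFun, if_neg (lt_irrefl 1)]
      exact rightDeriv_le_leftDeriv_one hf.convexOn_GFun hf.monotoneOn_GFun
        (fun q hq => hf.GFun_one_sub_le hw (hf.eq_of_F_eq_one hw hw1) hq) ⟨F_nonneg f v, hv1⟩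
  · have hv1 := hF.trans_lt hw1
    rw [ironedValue, ironedValue, gFun_of_lt hv1, gFun_of_lt hw1]
    exact monotoneOn_rightDeriv_Ico hf.convexOn_GFun hf.monotoneOn_GFun ⟨F_nonneg f v, hv1⟩
      ⟨F_nonneg f w, hw1⟩ hF

theorem gFun_nonneg (hf : IsValuationDensity a b f) {q : ℝ} (hq : q ∈ Ico (0 : ℝ) 1) :
    0 ≤ gFun a b f q := by
  rw [gFun_of_lt hq.2]
  exact rightDeriv_nonneg hf.monotoneOn_GFun hf.convexOn_GFun hq

theorem ironedValue_nonneg (hf : IsValuationDensity a b f) {v : ℝ} (hv : v ∈ valueRange a b) :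
    0 ≤ ironedValue a b f v := by
  have ha : a ∈ valueRange a b := mem_valueRange_of_le hv le_rfl hv.1
  refine le_trans ?_ (hf.monotoneOn_ironedValue ha hv hv.1)
  rw [ironedValue, hf.F_left]
  exact hf.gFun_nonneg ⟨le_rfl, one_pos⟩

theorem measurable_gFun : Measurable (gFun a b f) :=
  Measurable.ite measurableSet_Iio (measurable_derivWithin_Ioi _) measurable_const

theorem measurable_ironedValue : Measurable (ironedValue a b f) :=
  measurable_gFun.comp (measurable_F f)

/-- Each level set of the ironed virtual valuation has a smallest element. -/
theorem exists_isLeast_level (hf : IsValuationDensity a b f) {v : ℝ} (hv : v ∈ valueRange a b) :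
    ∃ r, IsLeast {w ∈ valueRange a b | ironedValue a b f w = ironedValue a b f v} r := by
  set S := {w ∈ valueRange a b | ironedValue a b f w = ironedValue a b f v}
  have hvS : v ∈ S := ⟨hv, rfl⟩
  have hbdd : BddBelow S := ⟨a, fun w hw => hw.1.1⟩
  have hrv : sInf S ≤ v := csInf_le hbdd hvS
  have hrR : sInf S ∈ valueRange a b :=
    mem_valueRange_of_le hv (le_csInf ⟨v, hvS⟩ fun w hw => hw.1.1) hrv
  refine ⟨sInf S, ⟨hrR, ?_⟩, fun w hw => csInf_le hbdd hw⟩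
  rcases hrv.eq_or_lt with hrv | hrv
  · rw [hrv]
  refine le_antisymm (hf.monotoneOn_ironedValue hrR hv hrv.le) ?_
  have hF := hf.strictMonoOn_F hrR hv hrv
  -- Right-continuity of `g` puts the infimum in the level set: each point just above it exceeds a
  -- member of `S`, so its ironed value is at least that of `v`.
  have h := le_rightDeriv_of_forall_Ioo hf.convexOn_GFun hf.monotoneOn_GFun hf.continuousOn_GFun
    (L := ironedValue a b f v) (F_nonneg f _) hF (F_le_one f v) fun q hq => ?_
  · rwa [← gFun_of_lt (hF.trans_le (F_le_one f v))] at h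
  · have hq1 : q < 1 := hq.2.trans_le (F_le_one f v)
    obtain ⟨w, hw, rfl⟩ := hf.exists_F_eq ⟨(F_nonneg f _).trans hq.1.le, hq1⟩
    have hrw := (hf.strictMonoOn_F.lt_iff_lt hrR hw).1 hq.1
    obtain ⟨s, hs, hsw⟩ := exists_lt_of_csInf_lt ⟨v, hvS⟩ hrw
    rw [← gFun_of_lt hq1, ← hs.2]
    exact hf.monotoneOn_ironedValue hs.1 hw hsw.le

/-- The bid is the least element `r` of the level set of `v`. An admissible bid in `(r, v]` would
have a strictly larger ironed value than `r`, against monotonicity. -/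
theorem exists_isGreatest_bid (hf : IsValuationDensity a b f) {v : ℝ} (hv : v ∈ valueRange a b) :
    ∃ r, IsGreatest {r ∈ bidSpace a b f | r ≤ v} r ∧
      ironedValue a b f r = ironedValue a b f v := by
  obtain ⟨r, hr, hmin⟩ := hf.exists_isLeast_level hv
  have hrv : r ≤ v := hmin ⟨hv, rfl⟩
  refine ⟨r, ⟨⟨⟨hr.1, fun w hw hwr => ?_⟩, hrv⟩, fun s hs => ?_⟩, hr.2⟩
  · refine lt_of_le_of_ne (hf.monotoneOn_ironedValue hw hr.1 hwr.le) fun h => ?_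
    exact not_le.2 hwr (hmin ⟨hw, h.trans hr.2⟩)
  · by_contra! hrs
    have h1 := hs.1.2 r hr.1 hrs
    rw [hr.2] at h1
    exact not_le.2 h1 (hf.monotoneOn_ironedValue hs.1.1 hv hs.2)

end IsValuationDensity

/-! ### Comparison of the tail measure with the ironed measure -/

/-- The measure whose density with respect to the law is the ironed virtual valuation. -/
def ironedMeasure (a : ℝ) (b : EReal) (f : ℝ → ℝ) : Measure ℝ :=
  (law f).withDensity fun v => ENNReal.ofReal (ironedValue a b f v)

instance nullSingletonClass_ironedMeasure (a : ℝ) (b : EReal) (f : ℝ → ℝ) :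
    NullSingletonClass (ironedMeasure a b f) :=
  ⟨fun x => withDensity_absolutelyContinuous _ _ (measure_singleton x)⟩

instance nullSingletonClass_tailMeasure (a : ℝ) (f : ℝ → ℝ) :
    NullSingletonClass (tailMeasure a f) :=
  ⟨fun x => IsValuationDensity.tailMeasure_absolutelyContinuous (measure_singleton x)⟩

namespace IsValuationDensity

variable {a : ℝ} {b : EReal} {f : ℝ → ℝ}

theorem ae_ironedMeasure (hf : IsValuationDensity a b f) :
    ∀ᵐ z ∂ironedMeasure a b f, z ∈ valueRange a b :=
  withDensity_absolutelyContinuous _ _ hf.law_compl_valueRange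

theorem tailMeasure_Ioi (hf : IsValuationDensity a b f) {v : ℝ} (hv : v ∈ valueRange a b) :
    tailMeasure a f (Ioi v) = ENNReal.ofReal (HFun a b f 1 - HFun a b f (F f v)) := by
  have := hf.isFiniteMeasure_tailMeasure
  rw [hf.HFun_one_sub hv, ofReal_measureReal]

/-- Push forward by `F` to the uniform law and apply the fundamental theorem of calculus to the
right derivative of `G`. -/
theorem ironedMeasure_Ioi (hf : IsValuationDensity a b f) {v : ℝ} (hv : v ∈ valueRange a b) :
    ironedMeasure a b f (Ioi v) = ENNReal.ofReal (GFun a b f 1 - GFun a b f (F f v)) := by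
  have hset : (Ioi v : Set ℝ) =ᵐ[law f] F f ⁻¹' Ioi (F f v) := by
    filter_upwards [hf.ae_mem_valueRange] with z hz
    exact propext (hf.strictMonoOn_F.lt_iff_lt hv hz).symm
  have hinter : Ioi (F f v) ∩ Ioc 0 1 = Ioc (F f v) 1 := by
    ext x
    simp only [mem_inter_iff, mem_Ioi, mem_Ioc]
    exact ⟨fun h => ⟨h.1, h.2.2⟩, fun h => ⟨h.1, (F_nonneg f v).trans_lt h.1, h.2⟩⟩
  have hmap := setLIntegral_map (μ := law f) (f := fun q => ENNReal.ofReal (gFun a b f q))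
    (g := F f) (measurableSet_Ioi (a := F f v)) measurable_gFun.ennreal_ofReal (measurable_F f)
  rw [ironedMeasure, withDensity_apply _ measurableSet_Ioi, Measure.restrict_congr_set hset]
  refine hmap.symm.trans ?_
  rw [hf.map_F_law, Measure.restrict_restrict measurableSet_Ioi, hinter,
    ← setIntegral_rightDeriv hf.convexOn_GFun hf.monotoneOn_GFun hf.continuousOn_GFun
      ⟨F_nonneg f v, F_le_one f v⟩]
  have hlt : ∀ᵐ q ∂volume.restrict (Ioc (F f v) 1), q ∈ Ico (0 : ℝ) 1 := by
    rw [← Measure.restrict_congr_set Ioo_ae_eq_Ioc]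
    filter_upwards [ae_restrict_mem measurableSet_Ioo] with q hq
      using ⟨(F_nonneg f v).trans hq.1.le, hq.2⟩
  rw [ofReal_integral_eq_lintegral_ofReal]
  · refine lintegral_congr_ae ?_
    filter_upwards [hlt] with q hq
    rw [gFun_of_lt hq.2]
  · exact (integrableOn_rightDeriv hf.convexOn_GFun hf.monotoneOn_GFun
      hf.continuousOn_GFun).mono_set (Ioc_subset_Ioc_left (F_nonneg f v))
  · filter_upwards [hlt] with q hq
      using rightDeriv_nonneg hf.monotoneOn_GFun hf.convexOn_GFun hq

/-- A set that is upward closed within the range is, up to null sets, a half-line. -/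
theorem ae_eq_Ioi_of_upper {m : Measure ℝ} [NullSingletonClass m]
    (hm : ∀ᵐ z ∂m, z ∈ valueRange a b) {U : Set ℝ}
    (hU : ∀ x ∈ U ∩ valueRange a b, ∀ y ∈ valueRange a b, x ≤ y → y ∈ U)
    (hne : (U ∩ valueRange a b).Nonempty) : U =ᵐ[m] Ioi (sInf (U ∩ valueRange a b)) := by
  set c := sInf (U ∩ valueRange a b)
  have hc : ∀ᵐ z ∂m, z ≠ c := by
    rw [ae_iff]
    simp
  filter_upwards [hm, hc] with z hz hzc
  refine propext ⟨fun hzU => ?_, fun hcz => ?_⟩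
  · exact lt_of_le_of_ne (csInf_le ⟨a, fun w hw => hw.2.1⟩ ⟨hzU, hz⟩) hzc.symm
  · obtain ⟨s, hs, hsz⟩ := exists_lt_of_csInf_lt hne hcz
    exact hU s hs z hz hsz.le

theorem sInf_upper_mem {U : Set ℝ} (hne : (U ∩ valueRange a b).Nonempty) :
    sInf (U ∩ valueRange a b) ∈ valueRange a b := by
  obtain ⟨x, hx⟩ := hne
  exact mem_valueRange_of_le hx.2 (le_csInf ⟨x, hx⟩ fun w hw => hw.2.1)
    (csInf_le ⟨a, fun w hw => hw.2.1⟩ hx)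

theorem measure_eq_zero_of_inter_empty {m : Measure ℝ} (hm : ∀ᵐ z ∂m, z ∈ valueRange a b)
    {U : Set ℝ} (hne : ¬ (U ∩ valueRange a b).Nonempty) : m U = 0 := by
  have hsub : U ⊆ (valueRange a b)ᶜ := fun x hx hxR => hne ⟨x, hx, hxR⟩
  exact measure_mono_null hsub hm

/-- The set is a half-line up to null sets, and there the claim is `G ≤ H` together with `G 1 = H
1`. -/
theorem tailMeasure_le_ironedMeasure (hf : IsValuationDensity a b f) {U : Set ℝ}
    (hU : ∀ x ∈ U ∩ valueRange a b, ∀ y ∈ valueRange a b, x ≤ y → y ∈ U) :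
    tailMeasure a f U ≤ ironedMeasure a b f U := by
  have htail : ∀ᵐ z ∂tailMeasure a f, z ∈ valueRange a b := hf.ae_tailMeasure.mono fun _ h => h.1
  by_cases hne : (U ∩ valueRange a b).Nonempty
  · rw [measure_congr (ae_eq_Ioi_of_upper htail hU hne),
      measure_congr (ae_eq_Ioi_of_upper hf.ae_ironedMeasure hU hne),
      hf.tailMeasure_Ioi (sInf_upper_mem hne), hf.ironedMeasure_Ioi (sInf_upper_mem hne),
      hf.GFun_one]
    exact ENNReal.ofReal_le_ofReal
      (sub_le_sub_left (hf.GFun_le_HFun ⟨F_nonneg f _, F_le_one f _⟩) _)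
  · rw [measure_eq_zero_of_inter_empty htail hne]
    exact zero_le

theorem tailMeasure_eq_ironedMeasure (hf : IsValuationDensity a b f) {U : Set ℝ}
    (hU : ∀ x ∈ U ∩ valueRange a b, ∀ y ∈ valueRange a b, x ≤ y → y ∈ U)
    (hsat : ∀ x ∈ valueRange a b, ∀ y ∈ valueRange a b,
      ironedValue a b f x = ironedValue a b f y → y ∈ U → x ∈ U) :
    tailMeasure a f U = ironedMeasure a b f U := by
  have htail : ∀ᵐ z ∂tailMeasure a f, z ∈ valueRange a b := hf.ae_tailMeasure.mono fun _ h => h.1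
  by_cases hne : (U ∩ valueRange a b).Nonempty
  · rw [measure_congr (ae_eq_Ioi_of_upper htail hU hne),
      measure_congr (ae_eq_Ioi_of_upper hf.ae_ironedMeasure hU hne),
      hf.tailMeasure_Ioi (sInf_upper_mem hne), hf.ironedMeasure_Ioi (sInf_upper_mem hne),
      hf.GFun_one]
    have hcR := sInf_upper_mem hne
    set c := sInf (U ∩ valueRange a b) with hc
    suffices h : GFun a b f (F f c) = HFun a b f (F f c) by rw [h]
    rcases (F_nonneg f c).eq_or_lt with h0 | h0
    · rw [← h0, HFun_zero]
      exact convexMinorant_zero (fun _ => hf.HFun_nonneg) HFun_zero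
    rcases (F_le_one f c).eq_or_lt with h1 | h1
    · rw [h1, hf.GFun_one]
    -- If `G < H` at the threshold `c`, the ironed value is constant on an interval around `c`.
    -- Saturation then pulls points below `c` into `U`, contradicting that `c` is the infimum.
    by_contra hneq
    obtain ⟨x, hx, y, hy, hxy⟩ := rightDeriv_convexMinorant_eq (fun _ => hf.HFun_nonneg) HFun_zero
      hf.continuousOn_HFun ⟨h0, h1⟩
      (lt_of_le_of_ne (hf.GFun_le_HFun ⟨F_nonneg f _, F_le_one f _⟩) hneq)
    obtain ⟨t, hct, hty⟩ := exists_between hy.1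
    have hx1 : x < 1 := hx.2.trans h1
    have ht1 : t < 1 := hty.trans hy.2
    obtain ⟨v, hv, rfl⟩ := hf.exists_F_eq ⟨hx.1.le, hx1⟩
    obtain ⟨w, hw, rfl⟩ := hf.exists_F_eq ⟨h0.le.trans hct.le, ht1⟩
    have hvc := (hf.strictMonoOn_F.lt_iff_lt hv hcR).1 hx.2
    have hcw := (hf.strictMonoOn_F.lt_iff_lt hcR hw).1 hct
    have hvw : ironedValue a b f v = ironedValue a b f w := by
      rw [ironedValue, ironedValue, gFun_of_lt hx1, gFun_of_lt ht1]
      exact (hxy _ ⟨le_rfl, hx.2.trans hy.1⟩).trans (hxy _ ⟨(hx.2.trans hct).le, hty⟩).symm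
    obtain ⟨s, hs, hsw⟩ := exists_lt_of_csInf_lt hne hcw
    have hvU := hsat v hv w hw hvw (hU s hs w hw hsw.le)
    exact not_le.2 hvc (csInf_le ⟨a, fun w hw => hw.2.1⟩ ⟨hvU, hv⟩)
  · rw [measure_eq_zero_of_inter_empty htail hne,
      measure_eq_zero_of_inter_empty hf.ae_ironedMeasure hne]

/-- Layer cake formula: superlevel sets of a monotone function are upward closed in the range. -/
theorem lintegral_tailMeasure_le (hf : IsValuationDensity a b f) {X : ℝ → ℝ} (hX : Measurable X)
    (h0 : ∀ v, 0 ≤ X v) (hmono : MonotoneOn X (valueRange a b)) :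
    ∫⁻ v, ENNReal.ofReal (X v) ∂tailMeasure a f ≤
      ∫⁻ v, ENNReal.ofReal (X v) ∂ironedMeasure a b f := by
  rw [lintegral_eq_lintegral_meas_lt _ (Eventually.of_forall h0) hX.aemeasurable,
    lintegral_eq_lintegral_meas_lt _ (Eventually.of_forall h0) hX.aemeasurable]
  exact lintegral_mono fun t => hf.tailMeasure_le_ironedMeasure fun x hx y hy hxy =>
    lt_of_lt_of_le hx.1 (hmono hx.2 hy hxy)

theorem lintegral_tailMeasure_eq (hf : IsValuationDensity a b f) {X : ℝ → ℝ} (hX : Measurable X)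
    (h0 : ∀ v, 0 ≤ X v) (hmono : MonotoneOn X (valueRange a b))
    (hlevel : ∀ x ∈ valueRange a b, ∀ y ∈ valueRange a b,
      ironedValue a b f x = ironedValue a b f y → X x = X y) :
    ∫⁻ v, ENNReal.ofReal (X v) ∂tailMeasure a f =
      ∫⁻ v, ENNReal.ofReal (X v) ∂ironedMeasure a b f := by
  rw [lintegral_eq_lintegral_meas_lt _ (Eventually.of_forall h0) hX.aemeasurable,
    lintegral_eq_lintegral_meas_lt _ (Eventually.of_forall h0) hX.aemeasurable]
  refine lintegral_congr fun t => hf.tailMeasure_eq_ironedMeasure (fun x hx y hy hxy =>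
    lt_of_lt_of_le hx.1 (hmono hx.2 hy hxy)) fun x hx y hy hxy hyU => ?_
  exact lt_of_lt_of_eq hyU (hlevel x hx y hy hxy).symm

end IsValuationDensity

/-! ### Winning probabilities -/

section WinProb

variable {n k : ℕ}

/-- The probability that `i` belongs to a random set with law `p`. -/
def winProb (p : PMF (Finset (Fin n))) (i : Fin n) : ℝ :=
  ∑ W : Finset (Fin n) with i ∈ W, (p W).toReal

theorem sum_toReal_pmf (p : PMF (Finset (Fin n))) : ∑ W, (p W).toReal = 1 := by
  rw [← ENNReal.toReal_sum fun W _ => p.apply_ne_top W, ← tsum_fintype (L := .unconditional _),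
    p.tsum_coe, ENNReal.toReal_one]

theorem winProb_nonneg (p : PMF (Finset (Fin n))) (i : Fin n) : 0 ≤ winProb p i :=
  Finset.sum_nonneg fun _ _ => ENNReal.toReal_nonneg

theorem winProb_le_one (p : PMF (Finset (Fin n))) (i : Fin n) : winProb p i ≤ 1 := by
  rw [← sum_toReal_pmf p]
  exact Finset.sum_le_sum_of_subset_of_nonneg (Finset.filter_subset _ _)
    fun _ _ _ => ENNReal.toReal_nonneg

theorem sum_winProb_mul (p : PMF (Finset (Fin n))) (y : Fin n → ℝ) :
    ∑ i, winProb p i * y i = ∑ W, (p W).toReal * ∑ i ∈ W, y i := by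
  simp_rw [winProb, Finset.sum_filter, Finset.sum_mul, ite_mul, zero_mul, Finset.mul_sum]
  rw [Finset.sum_comm]
  refine Finset.sum_congr rfl fun W _ => ?_
  rw [← Finset.sum_filter]
  simp

theorem sum_winProb_mul_le {p : PMF (Finset (Fin n))} {y : Fin n → ℝ} {T : ℝ}
    (h : ∀ W ∈ p.support, ∑ i ∈ W, y i ≤ T) : ∑ i, winProb p i * y i ≤ T := by
  rw [sum_winProb_mul]
  calc ∑ W, (p W).toReal * ∑ i ∈ W, y i ≤ ∑ W, (p W).toReal * T := by
        refine Finset.sum_le_sum fun W _ => ?_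
        by_cases hW : W ∈ p.support
        · exact mul_le_mul_of_nonneg_left (h W hW) ENNReal.toReal_nonneg
        · rw [(p.apply_eq_zero_iff W).2 hW]
          simp
    _ = T := by rw [← Finset.sum_mul, sum_toReal_pmf, one_mul]

theorem le_sum_winProb_mul {p : PMF (Finset (Fin n))} {y : Fin n → ℝ} {T : ℝ}
    (h : ∀ W ∈ p.support, T ≤ ∑ i ∈ W, y i) : T ≤ ∑ i, winProb p i * y i := by
  have h' := sum_winProb_mul_le (p := p) (y := fun i => -y i) (T := -T) fun W hW => by
    rw [Finset.sum_neg_distrib]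
    exact neg_le_neg (h W hW)
  simp only [mul_neg, Finset.sum_neg_distrib] at h'
  linarith

/-! ### Top sets maximize the sum of the bids -/

/-- Cancel the common part. The two differences have equal size, and the largest value in `W' \ W`
separates them. -/
theorem sum_le_sum_of_top {W W' : Finset (Fin n)} {y : Fin n → ℝ} (hcard : W'.card = W.card)
    (htop : ∀ i ∈ W, ∀ j ∉ W, y j ≤ y i) : ∑ i ∈ W', y i ≤ ∑ i ∈ W, y i := by
  classical
  have hc : (W' \ W).card = (W \ W').card := Finset.card_sdiff_comm hcard
  rw [← Finset.sum_inter_add_sum_sdiff W' W, ← Finset.sum_inter_add_sum_sdiff W W',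
    Finset.inter_comm]
  refine add_le_add le_rfl ?_
  rcases (W' \ W).eq_empty_or_nonempty with he | hne
  · have : W \ W' = ∅ := Finset.card_eq_zero.1 (hc ▸ Finset.card_eq_zero.2 he)
    rw [he, this]
  obtain ⟨j, hj, hmax⟩ := Finset.exists_max_image _ y hne
  calc ∑ i ∈ W' \ W, y i ≤ (W' \ W).card • y j := Finset.sum_le_card_nsmul _ _ _ hmax
    _ = (W \ W').card • y j := by rw [hc]
    _ ≤ ∑ i ∈ W \ W', y i := Finset.card_nsmul_le_sum _ _ _ fun i hi =>
        htop i (Finset.mem_sdiff.1 hi).1 j (Finset.mem_sdiff.1 hj).2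

theorem sum_le_sum_of_top_of_nonneg {W W' : Finset (Fin n)} {y : Fin n → ℝ}
    (hcard : W'.card ≤ W.card) (hy : ∀ i, 0 ≤ y i) (htop : ∀ i ∈ W, ∀ j ∉ W, y j ≤ y i) :
    ∑ i ∈ W', y i ≤ ∑ i ∈ W, y i := by
  obtain ⟨V, hV, hVc⟩ := Finset.exists_superset_card_eq hcard (Finset.card_le_univ W)
  exact (Finset.sum_le_sum_of_subset_of_nonneg hV fun i _ _ => hy i).trans
    (sum_le_sum_of_top hVc htop)

theorem mem_topSets {s : Fin n → ℝ} {W : Finset (Fin n)} :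
    W ∈ topSets k s ↔ W.card = min k n ∧ ∀ i ∈ W, ∀ j ∉ W, s j ≤ s i := by
  simp [topSets]

theorem mem_support_topLottery {s : Fin n → ℝ} {W : Finset (Fin n)} :
    W ∈ (topLottery k s).support ↔ W ∈ topSets k s :=
  PMF.mem_support_uniformOfFinset_iff _ _

theorem topProb_nonneg (s : Fin n → ℝ) (i : Fin n) : 0 ≤ topProb k s i := winProb_nonneg _ _

theorem topProb_le_one (s : Fin n → ℝ) (i : Fin n) : topProb k s i ≤ 1 := winProb_le_one _ _

/-- Serving the top bids maximizes the expected sum of values that are ordered like the bids. -/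
theorem sum_winProb_mul_le_topProb {p : PMF (Finset (Fin n))} (hp : ∀ W ∈ p.support, W.card ≤ k)
    {s y : Fin n → ℝ} (hy : ∀ i, 0 ≤ y i) (hsy : ∀ i j, s j ≤ s i → y j ≤ y i) :
    ∑ i, winProb p i * y i ≤ ∑ i, topProb k s i * y i := by
  obtain ⟨V, hV⟩ := topSets_nonempty k s
  rw [mem_topSets] at hV
  refine (sum_winProb_mul_le (T := ∑ i ∈ V, y i) fun W hW => ?_).trans
    (le_sum_winProb_mul fun W hW => ?_)
  · refine sum_le_sum_of_top_of_nonneg ?_ hy fun i hi j hj => hsy i j (hV.2 i hi j hj)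
    rw [hV.1]
    exact le_min (hp W hW) ((Finset.card_le_univ W).trans_eq (Fintype.card_fin n))
  · rw [mem_support_topLottery, mem_topSets] at hW
    exact sum_le_sum_of_top (hV.1.trans hW.1.symm) fun i hi j hj => hsy i j (hW.2 i hi j hj)

theorem sum_topProb_mul_self_le (s s' : Fin n → ℝ) :
    ∑ i, topProb k s' i * s i ≤ ∑ i, topProb k s i * s i := by
  obtain ⟨V, hV⟩ := topSets_nonempty k s
  rw [mem_topSets] at hV
  refine (sum_winProb_mul_le (T := ∑ i ∈ V, s i) fun W hW => ?_).trans
    (le_sum_winProb_mul fun W hW => ?_)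
  · rw [mem_support_topLottery, mem_topSets] at hW
    exact sum_le_sum_of_top (hW.1.trans hV.1.symm) hV.2
  · rw [mem_support_topLottery, mem_topSets] at hW
    exact sum_le_sum_of_top (hV.1.trans hW.1.symm) hW.2

/-- Exchange argument: each of the two lotteries maximizes the expected sum of its own bids. Adding
both inequalities cancels the other agents and leaves `(t' - t) * (x t' - x t) ≥ 0`. -/
theorem topProb_update_mono (s : Fin n → ℝ) (i : Fin n) :
    Monotone fun t => topProb k (Function.update s i t) i := by
  intro t t' htt'
  rcases htt'.eq_or_lt with rfl | hlt
  · rfl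
  have h1 := sum_topProb_mul_self_le (k := k) (Function.update s i t) (Function.update s i t')
  have h2 := sum_topProb_mul_self_le (k := k) (Function.update s i t') (Function.update s i t)
  rw [← Finset.add_sum_erase _ _ (Finset.mem_univ i),
    ← Finset.add_sum_erase _ _ (Finset.mem_univ i)] at h1 h2
  have hc : ∀ (x : Fin n → ℝ) (r : ℝ), ∑ j ∈ Finset.univ.erase i, x j * Function.update s i r j =
      ∑ j ∈ Finset.univ.erase i, x j * s j := fun x r =>
    Finset.sum_congr rfl fun j hj => by rw [Function.update_of_ne (Finset.ne_of_mem_erase hj)]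
  simp only [hc, Function.update_self] at h1 h2
  change topProb k (Function.update s i t) i ≤ topProb k (Function.update s i t') i
  nlinarith

/-! ### Symmetry -/

theorem map_mem_topSets_iff (π : Equiv.Perm (Fin n)) (s : Fin n → ℝ) (W : Finset (Fin n)) :
    π.finsetCongr W ∈ topSets k s ↔ W ∈ topSets k (s ∘ π) := by
  simp only [mem_topSets, Equiv.finsetCongr_apply, Finset.card_map, Function.comp_apply]
  refine and_congr_right fun _ => ?_
  refine ⟨fun h i hi j hj => h (π i) (by simpa using hi) (π j) (by simpa using hj),
    fun h i hi j hj => ?_⟩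
  rw [Finset.mem_map_equiv] at hi hj
  simpa using h (π.symm i) hi (π.symm j) hj

theorem card_topSets_comp (π : Equiv.Perm (Fin n)) (s : Fin n → ℝ) :
    (topSets k (s ∘ π)).card = (topSets k s).card :=
  Finset.card_equiv π.finsetCongr fun W => (map_mem_topSets_iff π s W).symm

theorem topLottery_comp_apply (π : Equiv.Perm (Fin n)) (s : Fin n → ℝ) (W : Finset (Fin n)) :
    topLottery k (s ∘ π) W = topLottery k s (π.finsetCongr W) := by
  rw [topLottery, topLottery, PMF.uniformOfFinset_apply, PMF.uniformOfFinset_apply,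
    card_topSets_comp]
  by_cases h : W ∈ topSets k (s ∘ π)
  · rw [if_pos h, if_pos ((map_mem_topSets_iff π s W).2 h)]
  · rw [if_neg h, if_neg (mt (map_mem_topSets_iff π s W).1 h)]

theorem topLottery_comp (π : Equiv.Perm (Fin n)) (s : Fin n → ℝ) :
    topLottery k (s ∘ π) = (topLottery k s).map fun W => W.map π.symm.toEmbedding := by
  classical
  ext W
  rw [topLottery_comp_apply, PMF.map_apply, tsum_eq_single (π.finsetCongr W)]
  · rw [if_pos]
    ext x
    simp
  · intro V hV
    rw [if_neg]
    rintro rfl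
    apply hV
    ext x
    simp

theorem topProb_comp (π : Equiv.Perm (Fin n)) (s : Fin n → ℝ) (i : Fin n) :
    topProb k (s ∘ π) i = topProb k s (π i) := by
  refine Finset.sum_equiv π.finsetCongr (fun W => ?_) fun W _ => by rw [topLottery_comp_apply]
  simp

/-! ### Measurability -/

theorem measurableSet_mem_topSets (W : Finset (Fin n)) :
    MeasurableSet {s : Fin n → ℝ | W ∈ topSets k s} := by
  simp only [mem_topSets]
  refine MeasurableSet.inter (MeasurableSet.const _) ?_
  have : {s : Fin n → ℝ | ∀ i ∈ W, ∀ j ∉ W, s j ≤ s i} =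
      ⋂ i ∈ W, ⋂ j ∈ (Wᶜ : Finset (Fin n)), {s : Fin n → ℝ | s j ≤ s i} := by
    ext s
    simp
  change MeasurableSet {s : Fin n → ℝ | ∀ i ∈ W, ∀ j ∉ W, s j ≤ s i}
  rw [this]
  exact Finset.measurableSet_biInter _ fun i _ => Finset.measurableSet_biInter _ fun j _ =>
    measurableSet_le (measurable_pi_apply j) (measurable_pi_apply i)

theorem measurable_topProb (i : Fin n) : Measurable fun s : Fin n → ℝ => topProb k s i := by
  classical
  have hcard : Measurable fun s : Fin n → ℝ => ((topSets k s).card : ℝ≥0∞) := by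
    have : (fun s : Fin n → ℝ => ((topSets k s).card : ℝ≥0∞)) =
        fun s => ∑ W : Finset (Fin n), if W ∈ topSets k s then 1 else 0 := by
      ext s
      rw [Finset.sum_boole]
      simp
    rw [this]
    exact Finset.measurable_fun_sum _ fun W _ =>
      Measurable.ite (measurableSet_mem_topSets W) measurable_const measurable_const
  refine Finset.measurable_fun_sum _ fun W _ => Measurable.ennreal_toReal ?_
  simp only [topLottery, PMF.uniformOfFinset_apply]
  exact Measurable.ite (measurableSet_mem_topSets W) hcard.inv measurable_const

end WinProb

/-! ### The envelope formula -/

theorem integral_bounds_of_monotoneOn {X : ℝ → ℝ} {s t : ℝ} (hst : s ≤ t)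
    (hX : MonotoneOn X (Icc s t)) :
    (t - s) * X s ≤ ∫ z in s..t, X z ∧ ∫ z in s..t, X z ≤ (t - s) * X t := by
  have hint : IntervalIntegrable X volume s t := by
    refine MonotoneOn.intervalIntegrable ?_
    rwa [uIcc_of_le hst]
  constructor
  · rw [← smul_eq_mul, ← intervalIntegral.integral_const]
    exact intervalIntegral.integral_mono_on hst intervalIntegrable_const hint
      fun z hz => hX ⟨le_rfl, hst⟩ hz hz.1
  · rw [← smul_eq_mul, ← intervalIntegral.integral_const]
    exact intervalIntegral.integral_mono_on hst hint intervalIntegrable_const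
      fun z hz => hX hz ⟨hst, le_rfl⟩ hz.2

theorem monotoneOn_of_subgradient {S : Set ℝ} {U X : ℝ → ℝ}
    (h : ∀ v ∈ S, ∀ w ∈ S, U w + (v - w) * X w ≤ U v) : MonotoneOn X S := by
  intro v hv w hw hvw
  rcases hvw.eq_or_lt with rfl | hlt
  · rfl
  nlinarith [h v hv w hw, h w hw v hv]

/-- A function with bounded subgradient `X` is a primitive of `X`. -/
theorem sub_eq_integral_of_subgradient {c d : ℝ} (hcd : c ≤ d) {U X : ℝ → ℝ}
    (h : ∀ v ∈ Icc c d, ∀ w ∈ Icc c d, U w + (v - w) * X w ≤ U v) :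
    U d - U c = ∫ z in c..d, X z := by
  have hX : MonotoneOn X (Icc c d) := monotoneOn_of_subgradient h
  have hint : ∀ s ∈ Icc c d, ∀ t ∈ Icc c d, IntervalIntegrable X volume s t := by
    intro s hs t ht
    refine (hX.mono ?_).intervalIntegrable
    exact ordConnected_Icc.uIcc_subset hs ht
  -- Both the increment of `U` and the integral lie between `(t - s) * X s` and `(t - s) * X t`. On
  -- a uniform partition these errors telescope to a multiple of `1 / (N + 1)`.
  have hstep : ∀ s ∈ Icc c d, ∀ t ∈ Icc c d, s ≤ t →
      |U t - U s - ∫ z in s..t, X z| ≤ (t - s) * (X t - X s) := by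
    intro s hs t ht hst
    have hb := integral_bounds_of_monotoneOn hst (hX.mono (Icc_subset_Icc hs.1 ht.2))
    have h1 := h t ht s hs
    have h2 := h s hs t ht
    rw [abs_le]
    constructor <;> nlinarith
  have hN : ∀ N : ℕ, |U d - U c - ∫ z in c..d, X z| ≤ (d - c) * (X d - X c) / (N + 1) := by
    intro N
    have hN0 : (0 : ℝ) < N + 1 := by positivity
    set t : ℕ → ℝ := fun j => c + j * ((d - c) / (N + 1)) with ht
    have hδ : 0 ≤ (d - c) / (N + 1) := div_nonneg (sub_nonneg.2 hcd) hN0.le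
    have ht0 : t 0 = c := by simp [ht]
    have htN : t (N + 1) = d := by
      simp only [ht, Nat.cast_add, Nat.cast_one]
      field_simp
      ring
    have htm : ∀ j, t (j + 1) - t j = (d - c) / (N + 1) := by
      intro j
      simp only [ht, Nat.cast_add, Nat.cast_one]
      ring
    have hmono : Monotone t := monotone_nat_of_le_succ fun j => by linarith [htm j]
    have hmem : ∀ j ≤ N + 1, t j ∈ Icc c d := fun j hj =>
      ⟨ht0 ▸ hmono (Nat.zero_le j), htN ▸ hmono hj⟩
    have hsum : U d - U c - ∫ z in c..d, X z =
        ∑ j ∈ Finset.range (N + 1), (U (t (j + 1)) - U (t j) - ∫ z in t j..t (j + 1), X z) := by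
      rw [Finset.sum_sub_distrib, Finset.sum_range_sub (fun j => U (t j)), htN, ht0,
        intervalIntegral.sum_integral_adjacent_intervals, htN, ht0]
      intro j hj
      exact hint _ (hmem j (by omega)) _ (hmem (j + 1) (by omega))
    rw [hsum]
    refine (Finset.abs_sum_le_sum_abs _ _).trans ?_
    calc ∑ j ∈ Finset.range (N + 1), |U (t (j + 1)) - U (t j) - ∫ z in t j..t (j + 1), X z|
        ≤ ∑ j ∈ Finset.range (N + 1), (d - c) / (N + 1) * (X (t (j + 1)) - X (t j)) := by
          refine Finset.sum_le_sum fun j hj => ?_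
          rw [Finset.mem_range] at hj
          rw [← htm j]
          exact hstep _ (hmem j (by omega)) _ (hmem (j + 1) (by omega)) (hmono (Nat.le_succ j))
      _ = (d - c) * (X d - X c) / (N + 1) := by
          rw [← Finset.mul_sum, Finset.sum_range_sub (fun j => X (t j)), htN, ht0]
          ring
  have hlim : Tendsto (fun N : ℕ => (d - c) * (X d - X c) / ((N : ℝ) + 1)) atTop (𝓝 0) := by
    have := (tendsto_one_div_add_atTop_nhds_zero_nat (𝕜 := ℝ)).const_mul ((d - c) * (X d - X c))
    simpa [div_eq_mul_inv] using this
  have h0 : |U d - U c - ∫ z in c..d, X z| ≤ 0 :=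
    ge_of_tendsto hlim (Eventually.of_forall hN)
  exact sub_eq_zero.1 (abs_nonpos_iff.1 h0)

/-! ### Redrawing one coordinate -/

theorem measurable_update_prod {n : ℕ} (i : Fin n) :
    Measurable fun p : ℝ × (Fin n → ℝ) => Function.update p.2 i p.1 := by
  refine measurable_pi_iff.2 fun j => ?_
  by_cases hj : j = i
  · subst hj
    simpa using measurable_fst
  · simp only [Function.update_of_ne hj]
    exact (measurable_pi_apply j).comp measurable_snd

/-- An independent redraw of coordinate `i` leaves the product law unchanged. This is how ex ante
expectations become integrals of interim quantities over the agent's own valuation. -/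
theorem measurePreserving_update {n : ℕ} (μ : Measure ℝ) [IsProbabilityMeasure μ] (i : Fin n) :
    MeasurePreserving (fun p : ℝ × (Fin n → ℝ) => Function.update p.2 i p.1)
      (μ.prod (Measure.pi fun _ => μ)) (Measure.pi fun _ => μ) := by
  refine ⟨measurable_update_prod i, (Measure.pi_eq fun s hs => ?_).symm⟩
  rw [Measure.map_apply (measurable_update_prod i) (MeasurableSet.univ_pi hs)]
  have hpre : (fun p : ℝ × (Fin n → ℝ) => Function.update p.2 i p.1) ⁻¹' univ.pi s =
      s i ×ˢ univ.pi (Function.update s i univ) := by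
    ext ⟨v, w⟩
    simp only [mem_preimage, mem_univ_pi, mem_prod]
    constructor
    · refine fun h => ⟨by simpa using h i, fun j => ?_⟩
      by_cases hj : j = i
      · subst hj; simp
      · simpa [Function.update_of_ne hj] using h j
    · rintro ⟨h1, h2⟩ j
      by_cases hj : j = i
      · subst hj; simpa using h1
      · simpa [Function.update_of_ne hj] using h2 j
  rw [hpre, Measure.prod_prod, Measure.pi_pi, ← Finset.mul_prod_erase _ _ (Finset.mem_univ i),
    ← Finset.mul_prod_erase _ (fun j => μ (s j)) (Finset.mem_univ i)]
  simp only [Function.update_self, measure_univ, one_mul]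
  congr 1
  exact Finset.prod_congr rfl fun j hj => by
    rw [Function.update_of_ne (Finset.ne_of_mem_erase hj)]

/-! ### Interim winning probabilities and the envelope formula for equilibria -/

namespace Mechanism

variable {n k : ℕ} {A : Type} {M : Mechanism n A} {a : ℝ} {b : EReal} {f : ℝ → ℝ}
  {σ : Fin n → ℝ → A}

theorem alloc_nonneg (M : Mechanism n A) (s : Fin n → A) (i : Fin n) : 0 ≤ M.alloc s i :=
  winProb_nonneg _ _

theorem alloc_le_one (M : Mechanism n A) (s : Fin n → A) (i : Fin n) : M.alloc s i ≤ 1 :=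
  winProb_le_one _ _

/-- The winning probability of agent `i` with valuation `v` when everybody follows `σ`. -/
def interimAlloc (M : Mechanism n A) (f : ℝ → ℝ) (σ : Fin n → ℝ → A) (i : Fin n) (v : ℝ) : ℝ :=
  ∫ w, M.alloc (fun j => σ j (Function.update w i v j)) i ∂(Measure.pi fun _ => law f)

theorem deviate_self (σ : Fin n → ℝ → A) (i : Fin n) (v : ℝ) (w : Fin n → ℝ) :
    deviate σ i (σ i v) w = fun j => σ j (Function.update w i v j) := by
  ext j
  by_cases hj : j = i
  · subst hj
    simp [deviate]
  · simp [deviate, Function.update_of_ne hj]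

theorem interimAlloc_nonneg (i : Fin n) (v : ℝ) : 0 ≤ M.interimAlloc f σ i v :=
  integral_nonneg fun _ => M.alloc_nonneg _ i

theorem interimAlloc_le_one (hf : IsValuationDensity a b f) (i : Fin n) (v : ℝ) :
    M.interimAlloc f σ i v ≤ 1 := by
  have := hf.isProbability
  have h := integral_mono_of_nonneg (μ := Measure.pi fun _ : Fin n => law f)
    (Eventually.of_forall fun w => M.alloc_nonneg (fun j => σ j (Function.update w i v j)) i)
    (integrable_const 1) (Eventually.of_forall fun w => M.alloc_le_one _ i)
  rwa [integral_const, probReal_univ, one_smul] at h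

theorem interimUtility_self (i : Fin n) (v u : ℝ) :
    M.interimUtility f σ i u (σ i v) = u * M.interimAlloc f σ i v -
      ∫ w, M.payment (fun j => σ j (Function.update w i v j)) i ∂(Measure.pi fun _ => law f) := by
  simp only [interimUtility, deviate_self, interimAlloc]

theorem lintegral_interimAlloc_ne_top (hf : IsValuationDensity a b f) (i : Fin n) :
    ∫⁻ v, ENNReal.ofReal (M.interimAlloc f σ i v) ∂tailMeasure a f ≠ ∞ := by
  have := hf.isFiniteMeasure_tailMeasure
  refine ((lintegral_mono fun v => ENNReal.ofReal_le_ofReal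
    (interimAlloc_le_one hf i v)).trans_lt ?_).ne
  rw [ENNReal.ofReal_one, lintegral_one]
  exact measure_lt_top _ _

variable [MeasurableSpace A]

theorem measurable_profile (hσ : ∀ i, Measurable (σ i)) :
    Measurable fun w : Fin n → ℝ => fun j => σ j (w j) :=
  measurable_pi_iff.2 fun j => (hσ j).comp (measurable_pi_apply j)

theorem measurable_profile_update (hσ : ∀ i, Measurable (σ i)) (i : Fin n) :
    Measurable fun p : ℝ × (Fin n → ℝ) => fun j => σ j (Function.update p.2 i p.1 j) :=
  (measurable_profile hσ).comp (measurable_update_prod i)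

theorem integrable_alloc (hf : IsValuationDensity a b f) (hM : M.IsFeasible k) (i : Fin n)
    {g : (Fin n → ℝ) → Fin n → A} (hg : Measurable g) :
    Integrable (fun w => M.alloc (g w) i) (Measure.pi fun _ => law f) := by
  have := hf.isProbability
  refine Integrable.of_bound ((hM.measurable_alloc i).comp hg).aestronglyMeasurable 1
    (Eventually.of_forall fun w => ?_)
  rw [Real.norm_of_nonneg (M.alloc_nonneg _ i)]
  exact M.alloc_le_one _ i

theorem measurable_interimAlloc (hf : IsValuationDensity a b f) (hM : M.IsFeasible k)
    (hσ : ∀ i, Measurable (σ i)) (i : Fin n) : Measurable (M.interimAlloc f σ i) := by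
  have := hf.isProbability
  have h : StronglyMeasurable fun p : ℝ × (Fin n → ℝ) =>
      M.alloc (fun j => σ j (Function.update p.2 i p.1 j)) i :=
    ((hM.measurable_alloc i).comp (measurable_profile_update hσ i)).stronglyMeasurable
  exact h.integral_prod_right'.measurable

/-- Type `v` does not gain by imitating type `w`, and the utility of a fixed action is affine in the
type. -/
theorem IsEquilibrium.subgradient (hσ : M.IsEquilibrium a b f σ) (i : Fin n) {v w : ℝ}
    (hv : v ∈ valueRange a b) (hw : w ∈ valueRange a b) :
    M.interimUtility f σ i w (σ i w) + (v - w) * M.interimAlloc f σ i w ≤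
      M.interimUtility f σ i v (σ i v) := by
  have h := hσ.best i v hv (σ i w) (hσ.finite i w hw)
  rw [interimUtility_self] at h ⊢
  linarith

theorem IsEquilibrium.monotoneOn_interimAlloc (hσ : M.IsEquilibrium a b f σ) (i : Fin n) :
    MonotoneOn (M.interimAlloc f σ i) (valueRange a b) :=
  monotoneOn_of_subgradient (U := fun v => M.interimUtility f σ i v (σ i v))
    fun _ hv _ hw => hσ.subgradient i hv hw

/-- For `a = 0` the utility of the lowest type is minus a nonnegative payment, while rationality
makes it nonnegative. -/
theorem IsEquilibrium.interimUtility_left (ha : 0 ≤ a) (hab : (a : EReal) < b)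
    (hM : M.IsFeasible k) (hσ : M.IsEquilibrium a b f σ) (i : Fin n) :
    M.interimUtility f σ i a (σ i a) = 0 := by
  rcases ha.eq_or_lt with rfl | ha
  · refine le_antisymm ?_ (hσ.rational i 0 (left_mem_valueRange hab))
    rw [interimUtility, zero_mul, zero_sub, neg_nonpos]
    exact integral_nonneg fun w => hM.payment_nonneg _ i
  · exact hσ.normalized ha i

theorem IsEquilibrium.interimUtility_eq (ha : 0 ≤ a) (hab : (a : EReal) < b)
    (hM : M.IsFeasible k) (hσ : M.IsEquilibrium a b f σ) (i : Fin n) {v : ℝ}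
    (hv : v ∈ valueRange a b) :
    M.interimUtility f σ i v (σ i v) = ∫ z in a..v, M.interimAlloc f σ i z := by
  have h := sub_eq_integral_of_subgradient (U := fun v => M.interimUtility f σ i v (σ i v)) hv.1
    fun x hx y hy => hσ.subgradient i (mem_valueRange_of_le hv hx.1 hx.2)
      (mem_valueRange_of_le hv hy.1 hy.2)
  rwa [hσ.interimUtility_left ha hab hM i, sub_zero] at h

/-! ### The residual surplus of an equilibrium -/

/-- Individual rationality bounds the interim payment of type `v` by `v`, which has finite mean. -/
theorem IsEquilibrium.integrable_payment (ha : 0 ≤ a) (hf : IsValuationDensity a b f) (hM : M.IsFeasible k)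
    (hσ : M.IsEquilibrium a b f σ) (i : Fin n) :
    Integrable (fun w => M.payment (fun j => σ j (w j)) i) (Measure.pi fun _ => law f) := by
  have := hf.isProbability
  have hmeas : Measurable fun p : ℝ × (Fin n → ℝ) =>
      M.payment (fun j => σ j (Function.update p.2 i p.1 j)) i :=
    (hM.measurable_payment i).comp (measurable_profile_update hσ.measurable i)
  refine ((measurePreserving_update (law f) i).integrable_comp
    ((hM.measurable_payment i).comp (measurable_profile hσ.measurable)).aestronglyMeasurable).1 ?_
  refine (integrable_prod_iff hmeas.aestronglyMeasurable).2 ⟨?_, ?_⟩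
  · filter_upwards [hf.ae_mem_valueRange] with v hv
    have h := hσ.finite i v hv
    simp only [FinitePayment, deviate_self] at h
    exact h
  · refine hf.mean.mono' hmeas.stronglyMeasurable.norm.integral_prod_right'.aestronglyMeasurable ?_
    filter_upwards [hf.ae_mem_valueRange] with v hv
    have h := hσ.rational i v hv
    rw [interimUtility_self] at h
    rw [Real.norm_of_nonneg (integral_nonneg fun _ => norm_nonneg _)]
    simp only [Real.norm_of_nonneg (hM.payment_nonneg _ i)]
    have hle := M.interimAlloc_le_one (σ := σ) hf i v
    have h0 := M.interimAlloc_nonneg (f := f) (σ := σ) i v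
    have hv0 := ha.trans hv.1
    nlinarith

theorem integrable_mul_alloc (hf : IsValuationDensity a b f) (hM : M.IsFeasible k)
    (hσ : ∀ i, Measurable (σ i)) (i : Fin n) :
    Integrable (fun w => w i * M.alloc (fun j => σ j (w j)) i) (Measure.pi fun _ => law f) := by
  have := hf.isProbability
  have hi : Integrable (fun w : Fin n → ℝ => w i) (Measure.pi fun _ => law f) :=
    (measurePreserving_eval (fun _ : Fin n => law f) i).integrable_comp_of_integrable hf.mean
  refine hi.norm.mono' ((measurable_pi_apply i).mul
    ((hM.measurable_alloc i).comp (measurable_profile hσ))).aestronglyMeasurable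
    (Eventually.of_forall fun w => ?_)
  rw [norm_mul, Real.norm_of_nonneg (M.alloc_nonneg _ i)]
  exact mul_le_of_le_one_right (norm_nonneg _) (M.alloc_le_one _ i)

theorem IsEquilibrium.integral_utility (ha : 0 ≤ a) (hf : IsValuationDensity a b f)
    (hM : M.IsFeasible k) (hσ : M.IsEquilibrium a b f σ) (i : Fin n) :
    ∫ w, (w i * M.alloc (fun j => σ j (w j)) i - M.payment (fun j => σ j (w j)) i)
      ∂(Measure.pi fun _ => law f) = ∫ v, M.interimUtility f σ i v (σ i v) ∂law f := by
  have := hf.isProbability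
  have hmp := measurePreserving_update (law f) i
  have hint := (integrable_mul_alloc hf hM hσ.measurable i).sub (hσ.integrable_payment ha hf hM i)
  have hint' := hmp.integrable_comp_of_integrable hint
  calc _ = ∫ p, (Function.update p.2 i p.1 i *
          M.alloc (fun j => σ j (Function.update p.2 i p.1 j)) i -
          M.payment (fun j => σ j (Function.update p.2 i p.1 j)) i)
          ∂((law f).prod (Measure.pi fun _ => law f)) := by
        conv_lhs => rw [← hmp.map_eq]
        refine integral_map hmp.measurable.aemeasurable ?_
        rw [hmp.map_eq]
        exact hint.aestronglyMeasurable
    _ = _ := by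
        refine (integral_prod _ hint').trans (integral_congr_ae ?_)
        filter_upwards [hf.ae_mem_valueRange] with v hv
        have hfin := hσ.finite i v hv
        simp only [FinitePayment, deviate_self] at hfin
        have halloc := integrable_alloc hf hM i (g := fun w j => σ j (Function.update w i v j))
          ((measurable_profile_update hσ.measurable i).comp measurable_prodMk_left)
        simp only [Function.comp_apply, Pi.sub_apply, Function.update_self]
        rw [integral_sub (halloc.const_mul v) hfin, integral_const_mul, interimUtility_self]
        rfl

theorem IsEquilibrium.integral_interimUtility (ha : 0 ≤ a) (hab : (a : EReal) < b)
    (hf : IsValuationDensity a b f) (hM : M.IsFeasible k) (hσ : M.IsEquilibrium a b f σ)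
    (i : Fin n) : ∫ v, M.interimUtility f σ i v (σ i v) ∂law f =
      (∫⁻ v, ENNReal.ofReal (M.interimAlloc f σ i v) ∂tailMeasure a f).toReal := by
  have := hf.isProbability
  have hX := measurable_interimAlloc hf hM hσ.measurable i
  have hP : StronglyMeasurable fun p : ℝ × (Fin n → ℝ) =>
      M.payment (fun j => σ j (Function.update p.2 i p.1 j)) i :=
    ((hM.measurable_payment i).comp
      (measurable_profile_update hσ.measurable i)).stronglyMeasurable
  rw [integral_eq_lintegral_of_nonneg_ae, hf.lintegral_tailMeasure hX.ennreal_ofReal]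
  · congr 1
    refine lintegral_congr_ae ?_
    filter_upwards [hf.ae_mem_valueRange] with v hv
    rw [hσ.interimUtility_eq ha hab hM i hv, intervalIntegral.integral_of_le hv.1,
      ofReal_integral_eq_lintegral_ofReal]
    · exact Integrable.of_bound hX.aestronglyMeasurable 1 (Eventually.of_forall fun z => by
        rw [Real.norm_of_nonneg (interimAlloc_nonneg i z)]
        exact interimAlloc_le_one hf i z)
    · exact Eventually.of_forall fun z => interimAlloc_nonneg i z
  · filter_upwards [hf.ae_mem_valueRange] with v hv using hσ.rational i v hv
  · simp only [interimUtility_self]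
    exact ((measurable_id.mul hX).sub hP.integral_prod_right'.measurable).aestronglyMeasurable

theorem IsEquilibrium.residualSurplus_eq (ha : 0 ≤ a) (hab : (a : EReal) < b)
    (hf : IsValuationDensity a b f) (hM : M.IsFeasible k) (hσ : M.IsEquilibrium a b f σ) :
    M.residualSurplus f σ =
      (∑ i, ∫⁻ v, ENNReal.ofReal (M.interimAlloc f σ i v) ∂tailMeasure a f).toReal := by
  have hint : ∀ i, Integrable (fun w => w i * M.alloc (fun j => σ j (w j)) i -
      M.payment (fun j => σ j (w j)) i) (Measure.pi fun _ => law f) := fun i =>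
    (integrable_mul_alloc hf hM hσ.measurable i).sub (hσ.integrable_payment ha hf hM i)
  rw [residualSurplus, integral_finsetSum _ fun i _ => hint i,
    ENNReal.toReal_sum fun i _ => lintegral_interimAlloc_ne_top hf i]
  exact Finset.sum_congr rfl fun i _ => (hσ.integral_utility ha hf hM i).trans
    (hσ.integral_interimUtility ha hab hf hM i)

/-- The virtual surplus, as an expectation over all valuations. -/
theorem sum_lintegral_ironedMeasure (hf : IsValuationDensity a b f) (hM : M.IsFeasible k)
    (hσ : ∀ i, Measurable (σ i)) :
    ∑ i, ∫⁻ v, ENNReal.ofReal (M.interimAlloc f σ i v) ∂ironedMeasure a b f =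
      ∫⁻ w, ENNReal.ofReal (∑ i, M.alloc (fun j => σ j (w j)) i * ironedValue a b f (w i))
        ∂(Measure.pi fun _ => law f) := by
  have := hf.isProbability
  have hiron : Measurable fun v => ENNReal.ofReal (ironedValue a b f v) :=
    IsValuationDensity.measurable_ironedValue.ennreal_ofReal
  have hterm : ∀ i, Measurable fun w : Fin n → ℝ => ENNReal.ofReal (ironedValue a b f (w i)) *
      ENNReal.ofReal (M.alloc (fun j => σ j (w j)) i) := fun i =>
    (hiron.comp (measurable_pi_apply i)).mul
      ((hM.measurable_alloc i).comp (measurable_profile hσ)).ennreal_ofReal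
  have hall : ∀ᵐ w ∂(Measure.pi fun _ : Fin n => law f), ∀ i, w i ∈ valueRange a b :=
    ae_all_iff.2 fun i => (measurePreserving_eval (fun _ : Fin n => law f)
      i).quasiMeasurePreserving.ae hf.ae_mem_valueRange
  have hpoint : (fun w : Fin n → ℝ => ENNReal.ofReal
      (∑ i, M.alloc (fun j => σ j (w j)) i * ironedValue a b f (w i)))
      =ᵐ[Measure.pi fun _ => law f] fun w => ∑ i, ENNReal.ofReal (ironedValue a b f (w i)) *
        ENNReal.ofReal (M.alloc (fun j => σ j (w j)) i) := by
    filter_upwards [hall] with w hw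
    rw [ENNReal.ofReal_sum_of_nonneg fun i _ =>
      mul_nonneg (M.alloc_nonneg _ i) (hf.ironedValue_nonneg (hw i))]
    exact Finset.sum_congr rfl fun i _ => by
      rw [← ENNReal.ofReal_mul (hf.ironedValue_nonneg (hw i)), mul_comm]
  rw [lintegral_congr_ae hpoint, lintegral_finsetSum _ fun i _ => hterm i]
  refine Finset.sum_congr rfl fun i _ => ?_
  have hmp := measurePreserving_update (law f) i
  refine Eq.trans ?_ ((lintegral_prod _ ((hterm i).comp hmp.measurable).aemeasurable).symm.trans
    (hmp.lintegral_comp (hterm i)))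
  rw [ironedMeasure, lintegral_withDensity_eq_lintegral_mul _ hiron
      (measurable_interimAlloc hf hM hσ i).ennreal_ofReal]
  refine lintegral_congr fun v => ?_
  have hprof : Measurable fun w : Fin n → ℝ => fun j => σ j (Function.update w i v j) :=
    (measurable_profile_update hσ i).comp measurable_prodMk_left
  simp only [Pi.mul_apply, Function.comp_apply, Function.update_self]
  have hm : Measurable fun w : Fin n → ℝ =>
      ENNReal.ofReal (M.alloc (fun j => σ j (Function.update w i v j)) i) :=
    ((hM.measurable_alloc i).comp hprof).ennreal_ofReal
  rw [lintegral_const_mul _ hm, interimAlloc,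
    ofReal_integral_eq_lintegral_ofReal (integrable_alloc hf hM i hprof)
      (Eventually.of_forall fun w => M.alloc_nonneg _ i)]

end Mechanism

/-! ### Equilibrium bids -/

namespace IsValuationDensity

variable {a : ℝ} {b : EReal} {f : ℝ → ℝ}

theorem isGreatest_roundDown (hf : IsValuationDensity a b f) {v : ℝ} (hv : v ∈ valueRange a b) :
    IsGreatest {r ∈ bidSpace a b f | r ≤ v} (roundDown a b f v) := by
  obtain ⟨r, hr, -⟩ := hf.exists_isGreatest_bid hv
  rwa [roundDown, hr.csSup_eq]

theorem ironedValue_roundDown (hf : IsValuationDensity a b f) {v : ℝ} (hv : v ∈ valueRange a b) :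
    ironedValue a b f (roundDown a b f v) = ironedValue a b f v := by
  obtain ⟨r, hr, h⟩ := hf.exists_isGreatest_bid hv
  rwa [roundDown, hr.csSup_eq]

theorem left_mem_bidSpace (hab : (a : EReal) < b) : a ∈ bidSpace a b f :=
  ⟨left_mem_valueRange hab, fun _ hw hwa => absurd hw.1 (not_le.2 hwa)⟩

theorem roundDown_of_mem {t : ℝ} (ht : t ∈ bidSpace a b f) : roundDown a b f t = t :=
  IsGreatest.csSup_eq ⟨⟨ht, le_rfl⟩, fun _ hr => hr.2⟩

theorem monotone_roundDown (ha : 0 ≤ a) (hab : (a : EReal) < b) :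
    Monotone (roundDown a b f) := by
  intro z z' hz
  have hbdd : ∀ z, BddAbove {r ∈ bidSpace a b f | r ≤ z} := fun z => ⟨z, fun r hr => hr.2⟩
  rcases le_or_gt a z with haz | hza
  · exact csSup_le_csSup (hbdd z') ⟨a, left_mem_bidSpace hab, haz⟩
      fun r hr => ⟨hr.1, hr.2.trans hz⟩
  -- Below `a` no bid is admissible and `sSup ∅ = 0`, so monotonicity across `a` relies on `0 ≤ a`.
  · have he : {r ∈ bidSpace a b f | r ≤ z} = ∅ :=
      eq_empty_of_forall_notMem fun r hr => not_le.2 hza (hr.1.1.1.trans hr.2)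
    rw [roundDown, he, Real.sSup_empty]
    exact Real.sSup_nonneg fun r hr => ha.trans hr.1.1.1

theorem ironedValue_le_of_roundDown_le (hf : IsValuationDensity a b f) {v w : ℝ}
    (hv : v ∈ valueRange a b) (hw : w ∈ valueRange a b)
    (h : roundDown a b f v ≤ roundDown a b f w) : ironedValue a b f v ≤ ironedValue a b f w := by
  rw [← hf.ironedValue_roundDown hv, ← hf.ironedValue_roundDown hw]
  exact hf.monotoneOn_ironedValue (hf.isGreatest_roundDown hv).1.1.1
    (hf.isGreatest_roundDown hw).1.1.1 h

theorem roundDown_le_of_ironedValue_le (hf : IsValuationDensity a b f) {v w : ℝ}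
    (hv : v ∈ valueRange a b) (hw : w ∈ valueRange a b)
    (h : ironedValue a b f v ≤ ironedValue a b f w) : roundDown a b f v ≤ roundDown a b f w := by
  by_contra! hlt
  have h' := (hf.isGreatest_roundDown hv).1.1.2 _ (hf.isGreatest_roundDown hw).1.1.1 hlt
  rw [hf.ironedValue_roundDown hv, hf.ironedValue_roundDown hw] at h'
  exact not_le.2 h' h

end IsValuationDensity

open IsValuationDensity

section Auction

variable {n k : ℕ} {a : ℝ} {b : EReal} {f : ℝ → ℝ}

open Classical in
/-- Bid the largest admissible bid that does not exceed the valuation. -/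
def bidStrategy (hab : (a : EReal) < b) (hf : IsValuationDensity a b f) (v : ℝ) :
    bidSpace a b f :=
  ⟨if v ∈ valueRange a b then roundDown a b f v else a, by
    split_ifs with hv
    · exact (hf.isGreatest_roundDown hv).1.1
    · exact left_mem_bidSpace hab⟩

theorem coe_bidStrategy (hab : (a : EReal) < b) (hf : IsValuationDensity a b f) {v : ℝ}
    (hv : v ∈ valueRange a b) : (bidStrategy hab hf v : ℝ) = roundDown a b f v := if_pos hv

theorem measurable_bidStrategy (ha : 0 ≤ a) (hab : (a : EReal) < b)
    (hf : IsValuationDensity a b f) : Measurable (bidStrategy hab hf) := by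
  classical
  exact (Measurable.ite (measurableSet_valueRange a b) (monotone_roundDown ha hab).measurable
    measurable_const).subtype_mk

theorem bidStrategy_eq_of_ironedValue_eq (hab : (a : EReal) < b) (hf : IsValuationDensity a b f)
    {v w : ℝ} (hv : v ∈ valueRange a b) (hw : w ∈ valueRange a b)
    (h : ironedValue a b f v = ironedValue a b f w) :
    bidStrategy hab hf v = bidStrategy hab hf w := by
  refine Subtype.ext ?_
  rw [coe_bidStrategy hab hf hv, coe_bidStrategy hab hf hw]
  exact le_antisymm (hf.roundDown_le_of_ironedValue_le hv hw h.le)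
    (hf.roundDown_le_of_ironedValue_le hw hv h.ge)

/-! ### Symmetry of the auction -/

theorem isSymmetric_indirectVickrey : (indirectVickrey n k a b f).IsSymmetric := by
  intro π s
  refine ⟨topLottery_comp π fun j => (s j : ℝ), fun i => ?_⟩
  have hz : ∀ z, topProb k (Function.update (fun j => (s (π j) : ℝ)) i z) i =
      topProb k (Function.update (fun j => (s j : ℝ)) (π i) z) (π i) := fun z => by
    rw [← topProb_comp π, Function.update_comp_eq_of_injective _ π.injective]
    rfl
  have hx : topProb k (fun j => (s (π j) : ℝ)) i = topProb k (fun j => (s j : ℝ)) (π i) :=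
    topProb_comp π (fun j => (s j : ℝ)) i
  simp only [indirectVickrey, Function.comp_apply, hz, hx]

/-! ### Individual bids -/

/-- The winning probability of agent `i` as a function of its valuation, given the other bids. -/
def winCurve (k : ℕ) (a : ℝ) (b : EReal) (f : ℝ → ℝ) (s : Fin n → ℝ) (i : Fin n) (z : ℝ) : ℝ :=
  topProb k (Function.update s i (roundDown a b f z)) i

theorem monotone_winCurve (ha : 0 ≤ a) (hab : (a : EReal) < b) (s : Fin n → ℝ) (i : Fin n) :
    Monotone (winCurve k a b f s i) :=
  (topProb_update_mono s i).comp (monotone_roundDown ha hab)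

theorem winCurve_nonneg (s : Fin n → ℝ) (i : Fin n) (z : ℝ) : 0 ≤ winCurve k a b f s i z :=
  topProb_nonneg _ _

theorem winCurve_update (s : Fin n → ℝ) (i : Fin n) (t : ℝ) :
    winCurve k a b f (Function.update s i t) i = winCurve k a b f s i := by
  ext z
  simp [winCurve]

theorem alloc_indirectVickrey (s : Fin n → bidSpace a b f) (i : Fin n) :
    (indirectVickrey n k a b f).alloc s i =
      winCurve k a b f (fun j => (s j : ℝ)) i (s i) := by
  rw [winCurve, roundDown_of_mem (s i).2, Function.update_eq_self i fun j => (s j : ℝ)]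
  rfl

theorem payment_indirectVickrey (s : Fin n → bidSpace a b f) (i : Fin n) :
    (indirectVickrey n k a b f).payment s i =
      (s i : ℝ) * winCurve k a b f (fun j => (s j : ℝ)) i (s i) -
        ∫ z in a..(s i : ℝ), winCurve k a b f (fun j => (s j : ℝ)) i z := by
  rw [← alloc_indirectVickrey]
  rfl

/-- The area under the increasing curve is at most `(s i - a)` times its final value, and `a ≥ 0`.
-/
theorem payment_indirectVickrey_nonneg (ha : 0 ≤ a) (hab : (a : EReal) < b)
    (s : Fin n → bidSpace a b f) (i : Fin n) : 0 ≤ (indirectVickrey n k a b f).payment s i := by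
  rw [payment_indirectVickrey]
  have h := (integral_bounds_of_monotoneOn (s i).2.1.1
    ((monotone_winCurve (k := k) (f := f) ha hab (fun j => (s j : ℝ)) i).monotoneOn _)).2
  nlinarith [winCurve_nonneg (k := k) (a := a) (b := b) (f := f) (fun j => (s j : ℝ)) i (s i)]

theorem payment_indirectVickrey_le (s : Fin n → bidSpace a b f) (i : Fin n) (ha : 0 ≤ a) :
    (indirectVickrey n k a b f).payment s i ≤ s i := by
  rw [payment_indirectVickrey]
  have h := intervalIntegral.integral_nonneg (μ := volume) (s i).2.1.1
    fun z _ => winCurve_nonneg (k := k) (a := a) (b := b) (f := f) (fun j => (s j : ℝ)) i z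
  have h1 : winCurve k a b f (fun j => (s j : ℝ)) i (s i) ≤ 1 := topProb_le_one _ _
  have h0 : 0 ≤ (s i : ℝ) := ha.trans (s i).2.1.1
  nlinarith

theorem measurable_coe_profile :
    Measurable fun s : Fin n → bidSpace a b f => fun j => (s j : ℝ) :=
  measurable_pi_iff.2 fun j => measurable_subtype_coe.comp (measurable_pi_apply j)

theorem measurable_winCurve (ha : 0 ≤ a) (hab : (a : EReal) < b) (i : Fin n) :
    Measurable fun p : (Fin n → bidSpace a b f) × ℝ =>
      winCurve k a b f (fun j => (p.1 j : ℝ)) i p.2 := by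
  have h : Measurable fun p : (Fin n → bidSpace a b f) × ℝ =>
      ((roundDown a b f p.2, fun j => (p.1 j : ℝ)) : ℝ × (Fin n → ℝ)) :=
    ((monotone_roundDown ha hab).measurable.comp measurable_snd).prodMk
      (measurable_coe_profile.comp measurable_fst)
  exact (measurable_topProb i).comp ((measurable_update_prod i).comp h)

theorem measurable_payment_indirectVickrey (ha : 0 ≤ a) (hab : (a : EReal) < b) (i : Fin n) :
    Measurable fun s => (indirectVickrey n k a b f).payment s i := by
  have hs : Measurable fun s : Fin n → bidSpace a b f => (s i : ℝ) :=
    measurable_subtype_coe.comp (measurable_pi_apply i)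
  refine (hs.mul ((measurable_topProb i).comp measurable_coe_profile)).sub ?_
  -- An indicator absorbs the upper limit, which depends on the bids, so the payment integral is a
  -- parametric integral over all of `ℝ`.
  have hset : MeasurableSet {p : (Fin n → bidSpace a b f) × ℝ | a < p.2 ∧ p.2 ≤ (p.1 i : ℝ)} :=
    (measurableSet_lt measurable_const measurable_snd).inter
      (measurableSet_le measurable_snd (hs.comp measurable_fst))
  have hm := ((measurable_winCurve (k := k) ha hab i).indicator
    hset).stronglyMeasurable.integral_prod_right' (ν := volume)
  convert hm.measurable using 2 with s
  rw [intervalIntegral.integral_of_le (s i).2.1.1, ← integral_indicator measurableSet_Ioc]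
  rfl

theorem isFeasible_indirectVickrey (ha : 0 ≤ a) (hab : (a : EReal) < b) :
    (indirectVickrey n k a b f).IsFeasible k where
  units s W hW := by
    have h := (mem_topSets.1 (mem_support_topLottery.1 hW)).1
    exact h.trans_le (min_le_left _ _)
  measurable_alloc i := (measurable_topProb i).comp measurable_coe_profile
  measurable_payment i := measurable_payment_indirectVickrey ha hab i
  payment_nonneg s i := payment_indirectVickrey_nonneg ha hab s i

/-! ### Truthful bidding is an equilibrium -/

/-- The ex-post utility of valuation `v` and bid `t` is at most the area under the curve. -/
theorem utility_le_integral {ξ : ℝ → ℝ} (hξ : Monotone ξ) (v t : ℝ) :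
    v * ξ t - (t * ξ t - ∫ z in a..t, ξ z) ≤ ∫ z in a..v, ξ z := by
  have hint : ∀ x y, IntervalIntegrable ξ volume x y := fun x y => hξ.intervalIntegrable
  have hadd := intervalIntegral.integral_add_adjacent_intervals (hint a t) (hint t v)
  rcases le_total t v with h | h
  · have := (integral_bounds_of_monotoneOn h (hξ.monotoneOn _)).1
    linarith
  · have := (integral_bounds_of_monotoneOn h (hξ.monotoneOn _)).2
    rw [intervalIntegral.integral_symm] at this
    linarith

/-- A monotone curve with equal values at `t` and `v` is flat between them, so no area is lost. -/
theorem utility_eq_integral {ξ : ℝ → ℝ} (hξ : Monotone ξ) {v t : ℝ} (htv : t ≤ v)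
    (heq : ξ v = ξ t) : v * ξ t - (t * ξ t - ∫ z in a..t, ξ z) = ∫ z in a..v, ξ z := by
  have hint : ∀ x y, IntervalIntegrable ξ volume x y := fun x y => hξ.intervalIntegrable
  have hadd := intervalIntegral.integral_add_adjacent_intervals (hint a t) (hint t v)
  have h := integral_bounds_of_monotoneOn htv (hξ.monotoneOn _)
  rw [heq] at h
  linarith [h.1, h.2]

theorem measurable_deviate {σ : Fin n → ℝ → bidSpace a b f} (hσ : ∀ i, Measurable (σ i))
    (i : Fin n) (t : bidSpace a b f) : Measurable (Mechanism.deviate σ i t) := by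
  refine measurable_pi_iff.2 fun j => ?_
  by_cases hj : j = i
  · subst hj
    simp [Mechanism.deviate]
  · simp only [Mechanism.deviate, Function.update_of_ne hj]
    exact (hσ j).comp (measurable_pi_apply j)

theorem integrable_payment_deviate (ha : 0 ≤ a) (hab : (a : EReal) < b)
    (hf : IsValuationDensity a b f) {σ : Fin n → ℝ → bidSpace a b f}
    (hσ : ∀ i, Measurable (σ i)) (i : Fin n) (t : bidSpace a b f) :
    (indirectVickrey n k a b f).FinitePayment f σ i t := by
  have := hf.isProbability
  refine Integrable.of_bound ((measurable_payment_indirectVickrey ha hab i).comp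
    (measurable_deviate hσ i t)).aestronglyMeasurable t (Eventually.of_forall fun w => ?_)
  rw [Real.norm_of_nonneg (payment_indirectVickrey_nonneg ha hab _ i)]
  refine (payment_indirectVickrey_le _ i ha).trans_eq ?_
  simp [Mechanism.deviate]

/-- Interim utility is the mean of ex-post utility; with integrability at hand, ex-post comparisons
can be integrated over the opponents. -/
theorem interimUtility_indirectVickrey (ha : 0 ≤ a) (hab : (a : EReal) < b)
    (hf : IsValuationDensity a b f) {σ : Fin n → ℝ → bidSpace a b f}
    (hσ : ∀ i, Measurable (σ i)) (i : Fin n) (v : ℝ) (t : bidSpace a b f) :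
    Integrable (fun w => v * winCurve k a b f (fun j => (σ j (w j) : ℝ)) i t -
      (t * winCurve k a b f (fun j => (σ j (w j) : ℝ)) i t -
        ∫ z in a..(t : ℝ), winCurve k a b f (fun j => (σ j (w j) : ℝ)) i z))
      (Measure.pi fun _ => law f) ∧
    (indirectVickrey n k a b f).interimUtility f σ i v t =
      ∫ w, (v * winCurve k a b f (fun j => (σ j (w j) : ℝ)) i t -
        (t * winCurve k a b f (fun j => (σ j (w j) : ℝ)) i t -
          ∫ z in a..(t : ℝ), winCurve k a b f (fun j => (σ j (w j) : ℝ)) i z))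
        ∂(Measure.pi fun _ => law f) := by
  have hpay := integrable_payment_deviate (k := k) ha hab hf hσ i t
  have halloc := Mechanism.integrable_alloc hf (isFeasible_indirectVickrey (n := n) (k := k)
    (f := f) ha hab) i (measurable_deviate hσ i t)
  have hcoe : ∀ w, (fun j => ((Mechanism.deviate σ i t w j : bidSpace a b f) : ℝ)) =
      Function.update (fun j => (σ j (w j) : ℝ)) i t := fun w => by
    ext j
    by_cases hj : j = i
    · subst hj
      simp [Mechanism.deviate]
    · simp [Mechanism.deviate, Function.update_of_ne hj]
  have hself : ∀ w, Mechanism.deviate σ i t w i = t := fun w => by simp [Mechanism.deviate]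
  unfold Mechanism.FinitePayment at hpay
  simp only [payment_indirectVickrey, hcoe, hself, winCurve_update] at hpay
  simp only [alloc_indirectVickrey, hcoe, hself, winCurve_update] at halloc
  refine ⟨(halloc.const_mul v).sub hpay, ?_⟩
  simp only [Mechanism.interimUtility, payment_indirectVickrey, alloc_indirectVickrey, hcoe, hself,
    winCurve_update]
  rw [integral_sub (halloc.const_mul v) hpay, integral_const_mul]

theorem utility_bidStrategy (ha : 0 ≤ a) (hab : (a : EReal) < b)
    (hf : IsValuationDensity a b f) (s : Fin n → ℝ) (i : Fin n) {v : ℝ}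
    (hv : v ∈ valueRange a b) :
    v * winCurve k a b f s i (bidStrategy hab hf v) -
      (bidStrategy hab hf v * winCurve k a b f s i (bidStrategy hab hf v) -
        ∫ z in a..(bidStrategy hab hf v : ℝ), winCurve k a b f s i z) =
      ∫ z in a..v, winCurve k a b f s i z := by
  rw [coe_bidStrategy hab hf hv]
  refine utility_eq_integral (monotone_winCurve ha hab s i) (hf.isGreatest_roundDown hv).1.2 ?_
  rw [winCurve, winCurve, roundDown_of_mem (hf.isGreatest_roundDown hv).1.1]

theorem isEquilibrium_indirectVickrey (ha : 0 ≤ a) (hab : (a : EReal) < b)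
    (hf : IsValuationDensity a b f) :
    (indirectVickrey n k a b f).IsEquilibrium a b f fun _ => bidStrategy hab hf := by
  have hσ : ∀ _ : Fin n, Measurable (bidStrategy hab hf) :=
    fun _ => measurable_bidStrategy ha hab hf
  refine ⟨hσ, fun i v _ => integrable_payment_deviate ha hab hf hσ i _, ?_, ?_, ?_⟩
  · intro i v hv t _
    obtain ⟨h1, h2⟩ := interimUtility_indirectVickrey (k := k) ha hab hf hσ i v t
    obtain ⟨h3, h4⟩ := interimUtility_indirectVickrey (k := k) ha hab hf hσ i v
      (bidStrategy hab hf v)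
    rw [h2, h4]
    refine integral_mono h1 h3 fun w => ?_
    exact (utility_le_integral (monotone_winCurve ha hab _ i) v t).trans_eq
      (utility_bidStrategy ha hab hf _ i hv).symm
  · intro i v hv
    rw [(interimUtility_indirectVickrey ha hab hf hσ i v _).2]
    refine integral_nonneg fun w => ?_
    change 0 ≤ _
    rw [utility_bidStrategy ha hab hf _ i hv]
    exact intervalIntegral.integral_nonneg hv.1 fun z _ => winCurve_nonneg _ i z
  · intro _ i
    rw [(interimUtility_indirectVickrey ha hab hf hσ i a _).2]
    simp only [utility_bidStrategy ha hab hf _ i (left_mem_valueRange hab),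
      intervalIntegral.integral_same, integral_zero]

/-! ### Optimality -/

theorem residualSurplus_le_indirectVickrey (ha : 0 ≤ a) (hab : (a : EReal) < b)
    (hf : IsValuationDensity a b f) {B : Type} [MeasurableSpace B] {M : Mechanism n B}
    {τ : Fin n → ℝ → B} (hM : M.IsFeasible k) (hτ : M.IsEquilibrium a b f τ) :
    M.residualSurplus f τ ≤
      (indirectVickrey n k a b f).residualSurplus f fun _ => bidStrategy hab hf := by
  have := hf.isProbability
  have hV := isFeasible_indirectVickrey (n := n) (k := k) (f := f) ha hab
  have hσ := isEquilibrium_indirectVickrey (n := n) (k := k) ha hab hf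
  rw [hτ.residualSurplus_eq ha hab hf hM, hσ.residualSurplus_eq ha hab hf hV]
  refine ENNReal.toReal_mono (ENNReal.sum_ne_top.2 fun i _ =>
    Mechanism.lintegral_interimAlloc_ne_top hf i) ?_
  have hall : ∀ᵐ w ∂(Measure.pi fun _ : Fin n => law f), ∀ i, w i ∈ valueRange a b :=
    ae_all_iff.2 fun i => (measurePreserving_eval (fun _ : Fin n => law f)
      i).quasiMeasurePreserving.ae hf.ae_mem_valueRange
  calc ∑ i, ∫⁻ v, ENNReal.ofReal (M.interimAlloc f τ i v) ∂tailMeasure a f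
      ≤ ∑ i, ∫⁻ v, ENNReal.ofReal (M.interimAlloc f τ i v) ∂ironedMeasure a b f :=
        Finset.sum_le_sum fun i _ => hf.lintegral_tailMeasure_le
          (Mechanism.measurable_interimAlloc hf hM hτ.measurable i)
          (Mechanism.interimAlloc_nonneg i) (hτ.monotoneOn_interimAlloc i)
    _ = _ := Mechanism.sum_lintegral_ironedMeasure hf hM hτ.measurable
    _ ≤ _ := by
        refine lintegral_mono_ae ?_
        filter_upwards [hall] with w hw
        refine ENNReal.ofReal_le_ofReal ?_
        -- Bids are ordered like ironed values, and equal bids mean equal ironed values, so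
        -- tie-breaking costs nothing.
        refine sum_winProb_mul_le_topProb (s := fun j => (bidStrategy hab hf (w j) : ℝ))
          (hM.units _) (fun i => hf.ironedValue_nonneg (hw i)) fun i j hij => ?_
        rw [coe_bidStrategy hab hf (hw i), coe_bidStrategy hab hf (hw j)] at hij
        exact hf.ironedValue_le_of_roundDown_le (hw j) (hw i) hij
    _ = _ := (Mechanism.sum_lintegral_ironedMeasure hf hV hσ.measurable).symm
    _ = _ := Finset.sum_congr rfl fun i _ => by
        refine (hf.lintegral_tailMeasure_eq
          (Mechanism.measurable_interimAlloc hf hV hσ.measurable i)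
          (Mechanism.interimAlloc_nonneg i) (hσ.monotoneOn_interimAlloc i) ?_).symm
        -- The valuation enters the winning probability only through the bid, which is common to
        -- each level set.
        intro x hx y hy hxy
        simp only [Mechanism.interimAlloc, ← Mechanism.deviate_self,
          bidStrategy_eq_of_ironedValue_eq hab hf hx hy hxy]

end Auction

end MoneyBurning

end

theorem mainTheorem11 (n k : ℕ) (a : ℝ) (b : EReal) (f : ℝ → ℝ) (ha : 0 ≤ a)
    (hab : (a : EReal) < b) (hf : MoneyBurning.IsValuationDensity a b f)
    (hnon : MoneyBurning.NonMHR a b f) :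
    (MoneyBurning.indirectVickrey n k a b f).IsSymmetric ∧
      ∃ σ : ℝ → MoneyBurning.bidSpace a b f,
        (∀ v ∈ MoneyBurning.valueRange a b,
          IsGreatest {r ∈ MoneyBurning.bidSpace a b f | r ≤ v} (σ v : ℝ) ∧
            MoneyBurning.ironedValue a b f (σ v) = MoneyBurning.ironedValue a b f v) ∧
        (MoneyBurning.indirectVickrey n k a b f).IsOptimal k a b f (fun _ => σ) := by
  refine ⟨MoneyBurning.isSymmetric_indirectVickrey, MoneyBurning.bidStrategy hab hf,
    fun v hv => ?_, ?_⟩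
  · rw [MoneyBurning.coe_bidStrategy hab hf hv]
    exact ⟨hf.isGreatest_roundDown hv, hf.ironedValue_roundDown hv⟩
  · exact ⟨MoneyBurning.isFeasible_indirectVickrey ha hab,
      MoneyBurning.isEquilibrium_indirectVickrey ha hab hf,
      fun _ _ _ _ hM hτ => MoneyBurning.residualSurplus_le_indirectVickrey ha hab hf hM hτ⟩
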